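/- **Setting.** Fix a smooth arclength-parametrized reference curve $\gamma_0:\mathbb R\to\mathbb R^3$ asymptotic at both ends to one oriented line. Let $BAL$ be the set of smooth arclength-parametrized curves $\gamma:\mathbb R\to\mathbb R^3$ such that the curvature $\kappa$ vanishes nowhere; $\gamma(s\pm\ell_\pm)-\gamma_0(s)\to0$ as $s\to\pm\infty$ for numbers $\ell_+=\ell_-$; $\kappa P\to 0$ at $\pm\infty$ for every polynomial $P$; and each of the functions $\kappa^{-1}\partial_s^n\kappa$, $\partial_s^n\tau$ ($n\ge0$, $\tau$ the torsion) is $o(P)$ at $\pm\infty$ for some nonzero polynomial $P$. Put $\ell=\ell_++\ell_-$. Let $T,N,B$ be the Frenet frame, $\int f=\int_{-\infty}^{\infty}f\,ds$, and $\partial_s^{-1}f(s)=\frac12\big(\int_{-\infty}^s f-\int_s^\infty f\big)$. Expressions are built from $\kappa,\kappa^{-1},\tau,s,\ell,1$ (and possibly variables of given degrees) by addition, real scaling, multiplication, $\partial_s$, $\partial_s^{-1}$ and $\int$. They are graded by $\mathbb Z$: $\kappa$ has degree $1$, $\kappa^{-1}$ degree $-1$, and $\tau,s,\ell,1$ degree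 $0$; degrees add under multiplication; sums of expressions of degree $n$, real scaling and $\partial_s$ preserve the degree; $\partial_s^{-1}$ and $\int$ are applied only in degree $2$ and give degree $0$; an expression of degree $n$ is also one of degree $n-1$. Let $\mathcal A_n$ be the scalar fields on $BAL\times\mathbb R$ that have an expression of degree $n$, let $\mathcal F$ be the algebra generated by $1$, $\ell$ and $\int\mathcal A_2$, and let $\mathcal X=\{gN+hB: g,h\in\mathcal A_1\}$ be the vector fields. Put $\wp(gN+hB)=\partial_s^{-1}(\kappa g)T+gN+hB$ and $\varphi(fT+gN+hB)=gN+hB$. For $X\in\mathcal X$ and $\tilde X=\wp X$, the variational derivative $\delta_X$ is computed on expressions: it is linear, obeys the product rule, commutes with $\partial_s,\partial_s^{-1},\int$, and satisfies $$\delta_X\kappa=\langle N,\nabla_s^2\tilde X\rangle,\quad \delta_X\tau=\partial_s\langle\kappa^{-1}B,\nabla_s^2\tilde X\rangle+\langle\kappa B,\nabla_s\tilde X\rangle,\quad \delta_Xs=0,\quad \delta_X\ell=\int\langle-\kappa N,\tilde X\rangle.$$ It extends to tangent fields by the product rule and $$\Delta_XT=\langle N,\nabla_s\tilde X\rangle N+\langle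 B,\nabla_s\tilde X\rangle B,\quad \Delta_XN=\langle\kappa^{-1}B,\nabla_s^2\tilde X\rangle B-\langle N,\nabla_s\tilde X\rangle T,\quad \Delta_XB=-\langle B,\nabla_s\tilde X\rangle T-\langle\kappa^{-1}B,\nabla_s^2\tilde X\rangle N.$$ Let $X$ act on functionals by $\delta_X$, and put $[X,Y]=\varphi(\Delta_X\wp Y-\Delta_Y\wp X)$. A $p$-form is an $\mathcal F$-multilinear, skew-symmetric map $\mathcal X^p\to\mathcal F$ given by an expression of degree $0$ in the components (variables of degree $1$) of its arguments. Put $$(L_X\omega)(U_1,\dots,U_p)=X(\omega(U_1,\dots,U_p))-\sum_i\omega(U_1,\dots,[X,U_i],\dots,U_p),$$ $$(d\eta)(U,V)=U(\eta(V))-V(\eta(U))-\eta([U,V])\quad\text{for a 1-form }\eta;$$ a 2-form is exact if it equals $d\eta$ for some 1-form $\eta$. Let $J(gN+hB)=hN-gB$, $R=J\circ\varphi\circ\nabla_s\circ\wp$, and $$\Omega_n(U,V)=\int\langle J^{-1}R^nU,V\rangle,\qquad X_n=R^n(\kappa B)\ (n\ge0),\qquad Y_n=R^{n-1}(s\kappa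 B)\ (n\ge1).$$ **Proposition (Lie derivatives of $\Omega_n$).** For all integers $m\ge1$ and $n\ge0$, $$L_{X_{m-1}}\Omega_n=0,\qquad L_{Y_m}\Omega_n=(3-m-n)\,\Omega_{m+n}.$$ Moreover, $\Omega_n$ is exact for every $n\ge1$ with $n\neq3$. -/

import Mathlib

open Filter Topology MeasureTheory Polynomial

noncomputable section

namespace VortexFilament

/-! ### Curves in Euclidean space and their Frenet data -/

/-- Euclidean three-space. -/
abbrev E3 := EuclideanSpace ℝ (Fin 3)

/-- The vector product of Euclidean three-space. -/
def cross (a b : E3) : E3 := WithLp.toLp 2 (crossProduct a.ofLp b.ofLp)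

/-- Infinitely extended smooth curves parametrized by arclength. -/
structure IsArclengthCurve (γ : ℝ → E3) : Prop where
  smooth : ContDiff ℝ (⊤ : ℕ∞) γ
  unit_speed : ∀ s, ‖deriv γ s‖ = 1

/-- The unit tangent `T = γ'`. -/
def tangent (γ : ℝ → E3) (s : ℝ) : E3 := deriv γ s

/-- The curvature `κ = |T'|`. -/
def curvature (γ : ℝ → E3) (s : ℝ) : ℝ := ‖deriv (tangent γ) s‖

/-- The principal normal `N = T' / κ` (meaningful where `κ ≠ 0`). -/
def normal (γ : ℝ → E3) (s : ℝ) : E3 := (curvature γ s)⁻¹ • deriv (tangent γ) s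

/-- The binormal `B = T × N`. -/
def binormal (γ : ℝ → E3) (s : ℝ) : E3 := cross (tangent γ s) (normal γ s)

/-- The torsion `τ = ⟨N', B⟩`. -/
def torsion (γ : ℝ → E3) (s : ℝ) : ℝ := inner ℝ (deriv (normal γ) s) (binormal γ s)

/-! ### Balanced asymptotically linear curves -/

/-- `f / P → 0` at `±∞` for some (nonzero) polynomial `P`. -/
def AsympPolyLike (f : ℝ → ℝ) : Prop :=
  ∃ P : ℝ[X], P ≠ 0 ∧ Tendsto (fun s => f s / P.eval s) (atBot ⊔ atTop) (𝓝 0)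

/-- `f P → 0` at `±∞` for every polynomial `P`. -/
def RapidlyDecreasing (f : ℝ → ℝ) : Prop :=
  ∀ P : ℝ[X], Tendsto (fun s => f s * P.eval s) (atBot ⊔ atTop) (𝓝 0)

/-- A reference curve: an arclength-parametrized smooth curve that is asymptotic, at both ends,
to one and the same oriented line `p + ℝ v`. -/
structure IsReferenceCurve (γ₀ : ℝ → E3) : Prop where
  arclength : IsArclengthCurve γ₀
  asymptotic : ∃ p v : E3, ∃ c : ℝ, ‖v‖ = 1 ∧
    Tendsto (fun s => γ₀ s - (p + s • v)) atTop (𝓝 0) ∧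
    Tendsto (fun s => γ₀ s - (p + (s + c) • v)) atBot (𝓝 0)

/-- `γ` is a balanced asymptotically linear curve relative to the reference curve `γ₀`. -/
structure IsBAL (γ₀ γ : ℝ → E3) : Prop where
  arclength : IsArclengthCurve γ
  curvature_ne_zero : ∀ s, curvature γ s ≠ 0
  /-- `γ(s ± ℓ_±)` approaches `γ₀(s)` as `s → ±∞`, with the same number `ℓ_+ = ℓ_-` at
  both ends. -/
  balanced : ∃ l : ℝ, Tendsto (fun s => γ (s + l) - γ₀ s) atTop (𝓝 0) ∧
    Tendsto (fun s => γ (s - l) - γ₀ s) atBot (𝓝 0)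
  curvature_rapid : RapidlyDecreasing (curvature γ)
  curvature_poly : ∀ n : ℕ,
    AsympPolyLike (fun s => (curvature γ s)⁻¹ * iteratedDeriv n (curvature γ) s)
  torsion_poly : ∀ n : ℕ, AsympPolyLike (iteratedDeriv n (torsion γ))

/-- The space of balanced asymptotically linear curves. -/
def BAL (γ₀ : ℝ → E3) : Type := {γ : ℝ → E3 // IsBAL γ₀ γ}

/-- The renormalized length `ℓ = ℓ_+ + ℓ_-`.  The number `ℓ_+ = ℓ_-` in the balancing
condition is unique, since the unit tangent of `γ` converges at the ends. -/
def renormalizedLength {γ₀ : ℝ → E3} (γ : BAL γ₀) : ℝ := 2 * γ.2.balanced.choose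

/-- Scalar fields: functions of a curve and a parameter value. -/
abbrev ScalarField (γ₀ : ℝ → E3) : Type := BAL γ₀ → ℝ → ℝ

/-! ### Expressions in `κ, κ⁻¹, τ, s, ℓ, 1` and variables -/

/-- Expressions built from `κ, κ⁻¹, τ, s, ℓ, 1` and variables indexed by `ι` by means of
addition, real scaling, multiplication, `∂_s`, `∂_s⁻¹` and `∫`. -/
inductive Expr (ι : Type) : Type
  | var (i : ι)
  | kappa
  | kappaInv
  | tau
  | arc
  | ell
  | one
  | add (a b : Expr ι)
  | smul (c : ℝ) (a : Expr ι)
  | mul (a b : Expr ι)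
  | ds (a : Expr ι)
  | dsInv (a : Expr ι)
  | int (a : Expr ι)

namespace Expr

variable {ι ι' : Type}

instance : Add (Expr ι) := ⟨Expr.add⟩
instance : Mul (Expr ι) := ⟨Expr.mul⟩
instance : Neg (Expr ι) := ⟨fun a => Expr.smul (-1) a⟩
instance : Sub (Expr ι) := ⟨fun a b => a + -b⟩

/-- The grading: `HasDegree d e n` says that `e` belongs to the `n`-th space of expressions, when
the variable `i` runs over the `d i`-th one.  In particular `∂_s⁻¹` and `∫` act on
expressions of degree `2` only. -/
inductive HasDegree (d : ι → ℤ) : Expr ι → ℤ → Prop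
  | var (i : ι) : HasDegree d (.var i) (d i)
  | kappa : HasDegree d .kappa 1
  | kappaInv : HasDegree d .kappaInv (-1)
  | tau : HasDegree d .tau 0
  | arc : HasDegree d .arc 0
  | ell : HasDegree d .ell 0
  | one : HasDegree d .one 0
  | add {a b : Expr ι} {n : ℤ} : HasDegree d a n → HasDegree d b n → HasDegree d (a + b) n
  | smul (c : ℝ) {a : Expr ι} {n : ℤ} : HasDegree d a n → HasDegree d (.smul c a) n
  | mul {a b : Expr ι} {i j : ℤ} :
      HasDegree d a i → HasDegree d b j → HasDegree d (a * b) (i + j)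
  | ds {a : Expr ι} {n : ℤ} : HasDegree d a n → HasDegree d (.ds a) n
  | dsInv {a : Expr ι} : HasDegree d a 2 → HasDegree d (.dsInv a) 0
  | int {a : Expr ι} : HasDegree d a 2 → HasDegree d (.int a) 0
  | weaken {a : Expr ι} {n : ℤ} : HasDegree d a n → HasDegree d a (n - 1)

/-- The scalar field denoted by an expression, the variables being assigned scalar fields. -/
def eval {γ₀ : ℝ → E3} (ρ : ι → ScalarField γ₀) : Expr ι → ScalarField γ₀
  | var i => ρ i
  | kappa => fun γ s => curvature γ.1 s
  | kappaInv => fun γ s => (curvature γ.1 s)⁻¹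
  | tau => fun γ s => torsion γ.1 s
  | arc => fun _ s => s
  | ell => fun γ _ => renormalizedLength γ
  | one => fun _ _ => 1
  | add a b => fun γ s => eval ρ a γ s + eval ρ b γ s
  | smul c a => fun γ s => c * eval ρ a γ s
  | mul a b => fun γ s => eval ρ a γ s * eval ρ b γ s
  | ds a => fun γ s => deriv (eval ρ a γ) s
  | dsInv a => fun γ s =>
      (1 / 2) * ((∫ t in Set.Iic s, eval ρ a γ t) - ∫ t in Set.Ioi s, eval ρ a γ t)
  | int a => fun γ _ => ∫ t, eval ρ a γ t

/-- Substitution of expressions for the variables. -/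
def subst (σ : ι → Expr ι') : Expr ι → Expr ι'
  | var i => σ i
  | kappa => kappa
  | kappaInv => kappaInv
  | tau => tau
  | arc => arc
  | ell => ell
  | one => one
  | add a b => add (subst σ a) (subst σ b)
  | smul c a => smul c (subst σ a)
  | mul a b => mul (subst σ a) (subst σ b)
  | ds a => ds (subst σ a)
  | dsInv a => dsInv (subst σ a)
  | int a => int (subst σ a)

end Expr

/-- Expressions without variables. -/
abbrev ClosedExpr : Type := Expr Empty

/-- The `n`-th space of closed expressions. -/
abbrev Expr.Mem (e : ClosedExpr) (n : ℤ) : Prop := Expr.HasDegree Empty.elim e n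

/-- The scalar field on the space of curves denoted by a closed expression. -/
def Expr.val (γ₀ : ℝ → E3) (e : ClosedExpr) : ScalarField γ₀ :=
  Expr.eval (fun i : Empty => i.elim) e

/-- The space `𝒜ₙ` of the scalar fields that have an expression of degree `n`. -/
def scalarSpace (γ₀ : ℝ → E3) (n : ℤ) : Set (ScalarField γ₀) :=
  {f | ∃ e : ClosedExpr, e.Mem n ∧ e.val γ₀ = f}

/-- The algebra `ℱ` of functionals, generated by `1`, `ℓ` and the integrals of elements
of `𝒜₂`. -/
def functionals (γ₀ : ℝ → E3) : Subalgebra ℝ (ScalarField γ₀) :=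
  Algebra.adjoin ℝ (insert (fun γ _ => renormalizedLength γ)
    {F | ∃ f ∈ scalarSpace γ₀ 2, F = fun γ _ => ∫ t, f γ t})

/-! ### Tangent fields and the recursion operator -/

/-- The tangent field `f T + g N + h B`. -/
structure TangentExpr (ι : Type) where
  t : Expr ι
  n : Expr ι
  b : Expr ι

/-- The normal field `g N + h B`; this is a tangent field modulo multiples of `T`. -/
structure NormalExpr (ι : Type) where
  n : Expr ι
  b : Expr ι

section
variable {ι : Type}

/-- The operator `∇_s`, by the product rule and the Frenet-Serret equations
`∇T = κN`, `∇N = -κT + τB`, `∇B = -τN`. -/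
def nabla (Z : TangentExpr ι) : TangentExpr ι where
  t := .ds Z.t - .kappa * Z.n
  n := .kappa * Z.t + .ds Z.n - .tau * Z.b
  b := .tau * Z.n + .ds Z.b

/-- The projection `φ` that forgets the component along `T`. -/
def phi (Z : TangentExpr ι) : NormalExpr ι := ⟨Z.n, Z.b⟩

/-- The injection `℘(g N + h B) = ∂_s⁻¹(κ g) T + g N + h B`. -/
def wp (X : NormalExpr ι) : TangentExpr ι := ⟨.dsInv (.kappa * X.n), X.n, X.b⟩

/-- `J X = ⟨B, X⟩ N - ⟨N, X⟩ B`. -/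
def opJ (X : NormalExpr ι) : NormalExpr ι := ⟨X.b, -X.n⟩

/-- The inverse of `J`. -/
def opJinv (X : NormalExpr ι) : NormalExpr ι := ⟨-X.b, X.n⟩

/-- The recursion operator `R = J ∘ φ ∘ ∇_s ∘ ℘`. -/
def opR (X : NormalExpr ι) : NormalExpr ι := opJ (phi (nabla (wp X)))

/-- The pointwise inner product of two normal fields. -/
def NormalExpr.inner (X Y : NormalExpr ι) : Expr ι := X.n * Y.n + X.b * Y.b

end

/-! ### Variational derivative, vector fields and their commutator -/

/-- The variation `δκ = ⟨N, ∇∇℘X⟩` of the curvature. -/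
def deltaKappa (X : NormalExpr Empty) : ClosedExpr := (nabla (nabla (wp X))).n

/-- The scalar `⟨κ⁻¹ B, ∇∇℘X⟩`. -/
def frameRotation (X : NormalExpr Empty) : ClosedExpr := .kappaInv * (nabla (nabla (wp X))).b

/-- The variational derivative `δ_{℘X}` of closed expressions: it is linear, obeys the
product rule, commutes with `∂_s`, `∂_s⁻¹`, `∫`, and
`δκ = ⟨N, ∇∇℘X⟩`, `δτ = ∂_s⟨κ⁻¹B, ∇∇℘X⟩ + ⟨κB, ∇℘X⟩`, `δs = 0`,
`δℓ = ∫⟨-κN, ℘X⟩`. -/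
def variation (X : NormalExpr Empty) : ClosedExpr → ClosedExpr
  | .var i => i.elim
  | .kappa => deltaKappa X
  | .kappaInv => -(.kappaInv * .kappaInv * deltaKappa X)
  | .tau => .ds (frameRotation X) + .kappa * (nabla (wp X)).b
  | .arc => .smul 0 .one
  | .ell => .int (-(.kappa * X.n))
  | .one => .smul 0 .one
  | .add a b => variation X a + variation X b
  | .smul c a => .smul c (variation X a)
  | .mul a b => variation X a * b + a * variation X b
  | .ds a => .ds (variation X a)
  | .dsInv a => .dsInv (variation X a)
  | .int a => .int (variation X a)

/-- The variational derivative of tangent fields, by the product rule and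
`δT = ⟨N,∇℘X⟩N + ⟨B,∇℘X⟩B`, `δN = ⟨κ⁻¹B,∇∇℘X⟩B - ⟨N,∇℘X⟩T`,
`δB = -⟨B,∇℘X⟩T - ⟨κ⁻¹B,∇∇℘X⟩N`. -/
def tangentVariation (X : NormalExpr Empty) (Z : TangentExpr Empty) : TangentExpr Empty where
  t := variation X Z.t - Z.n * (nabla (wp X)).n - Z.b * (nabla (wp X)).b
  n := variation X Z.n + Z.t * (nabla (wp X)).n - Z.b * frameRotation X
  b := variation X Z.b + Z.t * (nabla (wp X)).b + Z.n * frameRotation X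

/-- `D_X Y = φ(δ_{℘X}(℘Y))`. -/
def covariation (X Y : NormalExpr Empty) : NormalExpr Empty :=
  phi (tangentVariation X (wp Y))

/-- Both components are of degree `1`. -/
structure NormalExpr.IsVectorField (X : NormalExpr Empty) : Prop where
  n_mem : X.n.Mem 1
  b_mem : X.b.Mem 1

/-- Vector fields `g N + h B` with `g, h` of degree `1`, each given with expressions for
its components. -/
def VField : Type := {X : NormalExpr Empty // X.IsVectorField}

section degree
variable {ι : Type} {d : ι → ℤ}

theorem Expr.HasDegree.cast {a : Expr ι} {n m : ℤ} (h : Expr.HasDegree d a n) (e : n = m) :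
    Expr.HasDegree d a m := e ▸ h

theorem Expr.HasDegree.neg {a : Expr ι} {n : ℤ} (h : Expr.HasDegree d a n) : Expr.HasDegree d (-a) n :=
  h.smul (-1)

theorem Expr.HasDegree.sub {a b : Expr ι} {n : ℤ} (h : Expr.HasDegree d a n) (h' : Expr.HasDegree d b n) :
    Expr.HasDegree d (a - b) n := .add h (Expr.HasDegree.neg h')

theorem Expr.HasDegree.mul' {a b : Expr ι} {i j k : ℤ} (h : Expr.HasDegree d a i) (h' : Expr.HasDegree d b j)
    (e : i + j = k) : Expr.HasDegree d (a * b) k := Expr.HasDegree.cast (.mul h h') e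

/-- Componentwise degrees of a tangent field. -/
structure TangentExpr.Mem (Z : TangentExpr Empty) : Prop where
  t_mem : Z.t.Mem 0
  n_mem : Z.n.Mem 1
  b_mem : Z.b.Mem 1

theorem nabla_mem {Z : TangentExpr Empty} (h : Z.Mem) : (nabla Z).Mem where
  t_mem := Expr.HasDegree.sub (.ds h.t_mem)
    (Expr.HasDegree.cast (Expr.HasDegree.weaken (Expr.HasDegree.weaken (Expr.HasDegree.mul .kappa h.n_mem))) (by norm_num))
  n_mem := Expr.HasDegree.sub (.add (Expr.HasDegree.mul' .kappa h.t_mem (by norm_num)) (.ds h.n_mem))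
    (Expr.HasDegree.mul' .tau h.b_mem (by norm_num))
  b_mem := .add (Expr.HasDegree.mul' .tau h.n_mem (by norm_num)) (.ds h.b_mem)

theorem wp_mem {X : NormalExpr Empty} (h : X.IsVectorField) : (wp X).Mem where
  t_mem := .dsInv (Expr.HasDegree.mul' .kappa h.n_mem (by norm_num))
  n_mem := h.n_mem
  b_mem := h.b_mem

theorem opR_mem {X : NormalExpr Empty} (h : X.IsVectorField) : (opR X).IsVectorField where
  n_mem := (nabla_mem (wp_mem h)).b_mem
  b_mem := Expr.HasDegree.neg (nabla_mem (wp_mem h)).n_mem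

theorem frameRotation_mem {X : NormalExpr Empty} (h : X.IsVectorField) :
    (frameRotation X).Mem 0 :=
  Expr.HasDegree.mul' .kappaInv (nabla_mem (nabla_mem (wp_mem h))).b_mem (by norm_num)

theorem deltaKappa_mem {X : NormalExpr Empty} (h : X.IsVectorField) :
    (deltaKappa X).Mem 1 := (nabla_mem (nabla_mem (wp_mem h))).n_mem

theorem mem_zero_of_one {e : ClosedExpr} (h : e.Mem 1) : e.Mem 0 :=
  Expr.HasDegree.cast (.weaken h) (by norm_num)

theorem variation_mem {X : NormalExpr Empty} (h : X.IsVectorField) {e : ClosedExpr} {n : ℤ}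
    (he : e.Mem n) : (variation X e).Mem n := by
  induction he with
  | var i => exact i.elim
  | kappa => exact deltaKappa_mem h
  | kappaInv =>
    exact Expr.HasDegree.neg (Expr.HasDegree.mul' (.mul .kappaInv .kappaInv) (deltaKappa_mem h)
      (by norm_num))
  | tau =>
    exact .add (.ds (frameRotation_mem h)) (Expr.HasDegree.mul' .kappa
      (mem_zero_of_one (nabla_mem (wp_mem h)).b_mem) (by norm_num) |> mem_zero_of_one)
  | arc => exact .smul 0 .one
  | ell => exact .int (Expr.HasDegree.neg (Expr.HasDegree.mul' .kappa h.n_mem (by norm_num)))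
  | one => exact .smul 0 .one
  | add _ _ ih ih' => exact .add ih ih'
  | smul c _ ih => exact .smul c ih
  | mul ha hb ih ih' => exact .add (.mul ih hb) (.mul ha ih')
  | ds _ ih => exact .ds ih
  | dsInv _ ih => exact .dsInv ih
  | int _ ih => exact .int ih
  | weaken _ ih => exact .weaken ih

theorem covariation_mem {X Y : NormalExpr Empty} (hX : X.IsVectorField)
    (hY : Y.IsVectorField) : (covariation X Y).IsVectorField where
  n_mem := Expr.HasDegree.sub (.add (variation_mem hX hY.n_mem)
      (Expr.HasDegree.mul' (wp_mem hY).t_mem (nabla_mem (wp_mem hX)).n_mem (by norm_num)))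
    (Expr.HasDegree.mul' hY.b_mem (frameRotation_mem hX) (by norm_num))
  b_mem := .add (.add (variation_mem hX hY.b_mem)
      (Expr.HasDegree.mul' (wp_mem hY).t_mem (nabla_mem (wp_mem hX)).b_mem (by norm_num)))
    (Expr.HasDegree.mul' hY.n_mem (frameRotation_mem hX) (by norm_num))

end degree

/-- The commutator `[X, Y] = D_X Y - D_Y X` of vector fields. -/
def bracket (X Y : VField) : VField :=
  ⟨⟨(covariation X.1 Y.1).n - (covariation Y.1 X.1).n,
    (covariation X.1 Y.1).b - (covariation Y.1 X.1).b⟩,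
   ⟨Expr.HasDegree.sub (covariation_mem X.2 Y.2).n_mem (covariation_mem Y.2 X.2).n_mem,
    Expr.HasDegree.sub (covariation_mem X.2 Y.2).b_mem (covariation_mem Y.2 X.2).b_mem⟩⟩

/-- The recursion operator on vector fields. -/
def recursion (X : VField) : VField := ⟨opR X.1, opR_mem X.2⟩

/-- The vector field `κ B`. -/
def kappaB : VField := ⟨⟨.smul 0 .kappa, .kappa⟩, ⟨.smul 0 .kappa, .kappa⟩⟩

/-- The vector field `s κ B`. -/
def arcKappaB : VField :=
  ⟨⟨.smul 0 .kappa, .arc * .kappa⟩, ⟨.smul 0 .kappa, Expr.HasDegree.mul' .arc .kappa (by norm_num)⟩⟩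

/-- The symmetries `Xₙ = Rⁿ(κ B)`, `n ≥ 0`. -/
def symmetry (n : ℕ) : VField := recursion^[n] kappaB

/-- The master symmetries `Yₙ = Rⁿ⁻¹(s κ B)`, for `n ≥ 1`. -/
def masterSymmetry (n : ℕ) : VField := recursion^[n - 1] arcKappaB

/-! ### Differential forms -/

/-- Expressions in the components of `p` vector fields: the variables `(i, 0)` and `(i, 1)` stand
for the components of the `i`-th argument along `N` and `B`. -/
abbrev FormExpr (p : ℕ) : Type := Expr (Fin p × Fin 2)

/-- The generic `i`-th argument of a form. -/
def argument {p : ℕ} (i : Fin p) : NormalExpr (Fin p × Fin 2) := ⟨.var (i, 0), .var (i, 1)⟩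

/-- The value `ω(U₁, …, U_p)`, again as an expression. -/
def Expr.apply {p : ℕ} (ω : FormExpr p) (U : Fin p → VField) : ClosedExpr :=
  Expr.subst (fun k => if k.2 = 0 then (U k.1).1.n else (U k.1).1.b) ω

/-- A pair of scalar fields, seen as a normal field (first component along `N`, second along
`B`). -/
abbrev NormalField (γ₀ : ℝ → E3) : Type := Fin 2 → ScalarField γ₀

/-- The space `𝒳` of vector fields, as scalar fields: both components belong to `𝒜₁`. -/
def vectorFields (γ₀ : ℝ → E3) : Set (NormalField γ₀) := {X | ∀ k, X k ∈ scalarSpace γ₀ 1}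

/-- The value of a form on normal fields, as a scalar field. -/
def Expr.value {p : ℕ} {γ₀ : ℝ → E3} (ω : FormExpr p) (U : Fin p → NormalField γ₀) :
    ScalarField γ₀ := Expr.eval (fun k => U k.1 k.2) ω

/-- `ω` is a `p`-form: an expression of degree `0` in components of degree `1`, with values
in `ℱ`, which is `ℱ`-linear in each argument and skew-symmetric. -/
structure IsForm (γ₀ : ℝ → E3) {p : ℕ} (ω : FormExpr p) : Prop where
  degree : Expr.HasDegree (fun _ => 1) ω 0
  value_mem : ∀ U : Fin p → NormalField γ₀, (∀ i, U i ∈ vectorFields γ₀) →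
    ω.value U ∈ functionals γ₀
  map_add : ∀ U : Fin p → NormalField γ₀, (∀ i, U i ∈ vectorFields γ₀) →
    ∀ (i : Fin p), ∀ X ∈ vectorFields γ₀, ∀ Y ∈ vectorFields γ₀,
      ω.value (Function.update U i (X + Y)) =
        ω.value (Function.update U i X) + ω.value (Function.update U i Y)
  map_mul : ∀ U : Fin p → NormalField γ₀, (∀ i, U i ∈ vectorFields γ₀) →
    ∀ (i : Fin p), ∀ F ∈ functionals γ₀, ∀ X ∈ vectorFields γ₀,
      ω.value (Function.update U i (fun k => F * X k)) = F * ω.value (Function.update U i X)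
  skew : ∀ U : Fin p → NormalField γ₀, (∀ i, U i ∈ vectorFields γ₀) →
    ∀ i j : Fin p, i ≠ j → ω.value (U ∘ Equiv.swap i j) = -ω.value U

/-- The two-forms `Ωₙ(U, V) = ∫⟨J⁻¹ Rⁿ U, V⟩`, that is `Ωₙ = Ω₀ ∘ Rⁿ` for
`Ω₀(U, V) = ∫⟨J⁻¹ U, V⟩`. -/
def Omega (n : ℕ) : FormExpr 2 := .int ((opJinv (opR^[n] (argument 0))).inner (argument 1))

/-- The Lie derivative of a `p`-form, by the Leibniz rule:
`(L_X ω)(U₁, …, U_p) = X(ω(U₁, …, U_p)) - ∑ᵢ ω(U₁, …, [X, Uᵢ], …, U_p)`. -/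
def lieDeriv (γ₀ : ℝ → E3) {p : ℕ} (X : VField) (ω : FormExpr p) (U : Fin p → VField) :
    ScalarField γ₀ :=
  (variation X.1 (ω.apply U)).val γ₀ -
    ∑ i, (ω.apply (Function.update U i (bracket X (U i)))).val γ₀

/-- The exterior derivative of a one-form:
`(dη)(U₀, U₁) = U₀(η(U₁)) - U₁(η(U₀)) - η([U₀, U₁])`. -/
def extDeriv (γ₀ : ℝ → E3) (η : FormExpr 1) (U : Fin 2 → VField) : ScalarField γ₀ :=
  (variation (U 0).1 (η.apply ![U 1])).val γ₀ - (variation (U 1).1 (η.apply ![U 0])).val γ₀ -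
    (η.apply ![bracket (U 0) (U 1)]).val γ₀

/-- The two-form `ω` is exact: `ω = dη` for a one-form `η`. -/
def IsExact (γ₀ : ℝ → E3) (ω : FormExpr 2) : Prop :=
  ∃ η : FormExpr 1, IsForm γ₀ η ∧ ∀ U : Fin 2 → VField, extDeriv γ₀ η U = (ω.apply U).val γ₀

end VortexFilament

end

open Filter Topology MeasureTheory Polynomial

noncomputable section

namespace VortexFilament

/-! ### Functions all of whose derivatives are polynomially bounded -/

/-! Everything follows from algebra on one fixed curve, once the integrations by parts are
justified. Write ω = Ω₀.

Analysis: an expression of degree n is, along a curve, κⁿ times a function whose derivatives all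
have polynomial growth (`Expr.Mem.graded`). Degree at least 1 therefore means rapid decay, so
integrals converge and most boundary terms vanish. The exception is the tangential component of ℘X,
which has opposite limits at the two ends; a product of two such components has equal limits, and
the boundary term still cancels.

Geometry: ∇_s℘X has no tangential part, Δ_X commutes with ∇_s, and ℘[X,Y] = Δ_X℘Y − Δ_Y℘X. Hence
Ω₁(U,V) = ∫⟨∇_s℘U, ℘V⟩, so R is self-adjoint for ω, and ω, Ω₁, Ω₂ are all closed. For ω the cyclic
sum is the integral of the derivative of a determinant, for Ω₁ it cancels by parts, and for Ω₂ it
vanishes pointwise.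

Algebra (`IsHereditaryPair`): closedness of these three forms makes the Nijenhuis torsion of R
vanish, tested against ω (`nijenhuis`). If L_Xω = cΩ_k and L_X R = c'R^(k+1), then RX has the same
property with c + c', c', k + 1 (`scales_recursion`), and the Leibniz rule gives L_XΩₙ = (c +
nc')Ω_(k+n). For X = aκB with a affine of slope c, two integrations by parts give L_Xω = 2cΩ₁ and
L_X R = −cR² (`IsKappaBMultiple.scales`). Slope 0 is the case of κB; slope 1 is that of sκB and
produces the factor 3 − m − n.

Exactness is Cartan's formula: ω is closed, so d(ω(Yₙ, ·)) = L_{Yₙ}ω = (3 − n)Ωₙ. -/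

/-- Functions bounded by a multiple of a power of `1 + s²`. -/
def PolyBounded (f : ℝ → ℝ) : Prop := ∃ (C : ℝ) (k : ℕ), ∀ s, |f s| ≤ C * (1 + s ^ 2) ^ k

namespace PolyBounded

theorem exists_nonneg {f : ℝ → ℝ} (hf : PolyBounded f) :
    ∃ (C : ℝ) (k : ℕ), 0 ≤ C ∧ ∀ s, |f s| ≤ C * (1 + s ^ 2) ^ k := by
  obtain ⟨C, k, h⟩ := hf
  refine ⟨C, k, ?_, h⟩
  simpa using (abs_nonneg _).trans (h 0)

theorem of_bound {f : ℝ → ℝ} (C : ℝ) (h : ∀ s, |f s| ≤ C) : PolyBounded f :=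
  ⟨C, 0, fun s => by simpa using h s⟩

theorem add {f g : ℝ → ℝ} (hf : PolyBounded f) (hg : PolyBounded g) :
    PolyBounded (fun s => f s + g s) := by
  obtain ⟨C, k, hC, h⟩ := hf.exists_nonneg
  obtain ⟨C', k', hC', h'⟩ := hg.exists_nonneg
  refine ⟨C + C', k + k', fun s => (abs_add_le _ _).trans ?_⟩
  have h1 : (1 : ℝ) ≤ 1 + s ^ 2 := by nlinarith [sq_nonneg s]
  have e1 : (1 + s ^ 2) ^ k ≤ (1 + s ^ 2) ^ (k + k') := pow_le_pow_right₀ h1 (by omega)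
  have e2 : (1 + s ^ 2) ^ k' ≤ (1 + s ^ 2) ^ (k + k') := pow_le_pow_right₀ h1 (by omega)
  calc |f s| + |g s| ≤ C * (1 + s ^ 2) ^ k + C' * (1 + s ^ 2) ^ k' := add_le_add (h s) (h' s)
    _ ≤ C * (1 + s ^ 2) ^ (k + k') + C' * (1 + s ^ 2) ^ (k + k') := by gcongr
    _ = _ := by ring

theorem mul {f g : ℝ → ℝ} (hf : PolyBounded f) (hg : PolyBounded g) :
    PolyBounded (fun s => f s * g s) := by
  obtain ⟨C, k, hC, h⟩ := hf.exists_nonneg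
  obtain ⟨C', k', hC', h'⟩ := hg.exists_nonneg
  refine ⟨C * C', k + k', fun s => ?_⟩
  rw [abs_mul]
  calc |f s| * |g s| ≤ (C * (1 + s ^ 2) ^ k) * (C' * (1 + s ^ 2) ^ k') := by
        gcongr
        · exact h s
        · exact h' s
    _ = _ := by ring

theorem const (c : ℝ) : PolyBounded (fun _ => c) := of_bound |c| fun _ => le_rfl

theorem id : PolyBounded (fun s => s) :=
  ⟨1, 1, fun s => by rw [pow_one, one_mul]; nlinarith [abs_nonneg s, sq_abs s, sq_nonneg (|s| - 1)]⟩

theorem eval (P : ℝ[X]) : PolyBounded (fun s => P.eval s) := by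
  induction P using Polynomial.induction_on' with
  | add p q hp hq => simpa using hp.add hq
  | monomial n a =>
    induction n with
    | zero => simpa using const a
    | succ n ih =>
      have := ih.mul id
      simp only [Polynomial.eval_monomial] at this ⊢
      simpa only [pow_succ, mul_assoc] using this

theorem of_asympPolyLike {f : ℝ → ℝ} (hf : AsympPolyLike f) (hc : Continuous f) :
    PolyBounded f := by
  obtain ⟨P, hP, h⟩ := hf
  have h1 : ∀ᶠ s in atBot ⊔ atTop, |f s / P.eval s| ≤ 1 := by
    have h0 := h.abs
    rw [abs_zero] at h0
    exact h0.eventually (ge_mem_nhds one_pos)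
  rw [← cocompact_eq_atBot_atTop] at h1
  -- At a root of P the quotient is 0 by convention and bounds nothing; the finitely many roots are
  -- moved into the compact set.
  have h2 : ∀ᶠ s in cocompact ℝ, P.eval s ≠ 0 := by
    have : {s : ℝ | P.IsRoot s}.Finite := Polynomial.finite_setOfPred_isRoot hP
    filter_upwards [this.isCompact.compl_mem_cocompact] with s hs using hs
  obtain ⟨K, hK, hKs⟩ := mem_cocompact.1 (h1.and h2)
  obtain ⟨C, hC⟩ := hK.exists_bound_of_continuousOn hc.continuousOn
  obtain ⟨D, k, hD, hPk⟩ := (eval P).exists_nonneg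
  refine ⟨|C| + D, k, fun s => ?_⟩
  have h1 : (1 : ℝ) ≤ (1 + s ^ 2) ^ k := one_le_pow₀ (by nlinarith [sq_nonneg s])
  by_cases hs : s ∈ K
  · have e1 := hC s hs
    rw [Real.norm_eq_abs] at e1
    nlinarith [le_abs_self C, abs_nonneg C, mul_nonneg hD (sub_nonneg.2 h1),
      mul_nonneg (abs_nonneg C) (sub_nonneg.2 h1)]
  · obtain ⟨e1, e2⟩ := hKs hs
    rw [abs_div, div_le_one (abs_pos.2 e2)] at e1
    nlinarith [hPk s, mul_nonneg (abs_nonneg C) (zero_le_one.trans h1)]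

end PolyBounded

/-- Functions whose derivatives up to order `n` exist and are polynomially bounded. -/
def TameOrder : ℕ → (ℝ → ℝ) → Prop
  | 0, f => PolyBounded f
  | n + 1, f => PolyBounded f ∧ Differentiable ℝ f ∧ TameOrder n (deriv f)

namespace TameOrder

theorem polyBounded {n : ℕ} {f : ℝ → ℝ} (h : TameOrder n f) : PolyBounded f := by
  cases n with
  | zero => exact h
  | succ n => exact h.1

theorem of_succ {n : ℕ} {f : ℝ → ℝ} (h : TameOrder (n + 1) f) : TameOrder n f := by
  induction n generalizing f with
  | zero => exact h.1
  | succ n ih => exact ⟨h.1, h.2.1, ih h.2.2⟩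

theorem add {n : ℕ} {f g : ℝ → ℝ} (hf : TameOrder n f) (hg : TameOrder n g) :
    TameOrder n (fun s => f s + g s) := by
  induction n generalizing f g with
  | zero => exact PolyBounded.add hf hg
  | succ n ih =>
    refine ⟨hf.1.add hg.1, hf.2.1.add hg.2.1, ?_⟩
    convert ih hf.2.2 hg.2.2 using 1
    funext s
    exact deriv_fun_add (hf.2.1 s) (hg.2.1 s)

theorem mul {n : ℕ} {f g : ℝ → ℝ} (hf : TameOrder n f) (hg : TameOrder n g) :
    TameOrder n (fun s => f s * g s) := by
  induction n generalizing f g with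
  | zero => exact PolyBounded.mul hf hg
  | succ n ih =>
    refine ⟨hf.1.mul hg.1, hf.2.1.mul hg.2.1, ?_⟩
    convert (ih hf.2.2 hg.of_succ).add (ih hf.of_succ hg.2.2) using 1
    funext s
    exact deriv_fun_mul (hf.2.1 s) (hg.2.1 s)

theorem const (c : ℝ) (n : ℕ) : TameOrder n (fun _ => c) := by
  induction n generalizing c with
  | zero => exact PolyBounded.const c
  | succ n ih =>
    refine ⟨PolyBounded.const c, differentiable_const c, ?_⟩
    simpa using ih 0

end TameOrder

/-- Smooth functions all of whose derivatives are polynomially bounded. -/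
def Tame (f : ℝ → ℝ) : Prop := ∀ n, TameOrder n f

namespace Tame

theorem differentiable {f : ℝ → ℝ} (h : Tame f) : Differentiable ℝ f := (h 1).2.1

theorem deriv {f : ℝ → ℝ} (h : Tame f) : Tame (deriv f) := fun n => (h (n + 1)).2.2

theorem of_deriv {f : ℝ → ℝ} (hb : PolyBounded f) (hd : Differentiable ℝ f)
    (h : Tame (_root_.deriv f)) : Tame f := by
  intro n
  cases n with
  | zero => exact hb
  | succ n => exact ⟨hb, hd, h n⟩

theorem add {f g : ℝ → ℝ} (hf : Tame f) (hg : Tame g) : Tame (fun s => f s + g s) :=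
  fun n => (hf n).add (hg n)

theorem mul {f g : ℝ → ℝ} (hf : Tame f) (hg : Tame g) : Tame (fun s => f s * g s) :=
  fun n => (hf n).mul (hg n)

theorem const (c : ℝ) : Tame (fun _ => c) := TameOrder.const c

theorem id : Tame (fun s => s) := by
  refine of_deriv PolyBounded.id differentiable_fun_id ?_
  simpa using const 1

end Tame

/-! ### Frenet data -/

/-- Curvature and torsion functions with the decay and growth of those of a balanced
asymptotically linear curve. -/
structure FrenetData (κ τ : ℝ → ℝ) : Prop where
  ne_zero : ∀ s, κ s ≠ 0
  decay : ∀ k : ℕ, ∃ C : ℝ, ∀ s, |κ s| * (1 + s ^ 2) ^ k ≤ C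
  differentiable : Differentiable ℝ κ
  logDeriv_tame : Tame (fun s => (κ s)⁻¹ * deriv κ s)
  tau_tame : Tame τ

/-- Functions of the form `κⁿ p` with `p` tame. -/
def Graded (κ : ℝ → ℝ) (n : ℤ) (f : ℝ → ℝ) : Prop := ∃ p, Tame p ∧ f = fun s => κ s ^ n * p s

/-- The primitive `∂⁻¹ f` whose limits at the two ends are opposite to each other. -/
def balancedPrimitive (f : ℝ → ℝ) (s : ℝ) : ℝ :=
  (1 / 2) * ((∫ t in Set.Iic s, f t) - ∫ t in Set.Ioi s, f t)

/-- The limits at the two ends are opposite to each other. -/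
def Balanced (f : ℝ → ℝ) : Prop := ∃ c, Tendsto f atTop (𝓝 c) ∧ Tendsto f atBot (𝓝 (-c))

theorem Balanced.add {f g : ℝ → ℝ} (hf : Balanced f) (hg : Balanced g) :
    Balanced (fun s => f s + g s) := by
  obtain ⟨c, h1, h2⟩ := hf
  obtain ⟨d, h3, h4⟩ := hg
  exact ⟨c + d, h1.add h3, by rw [neg_add]; exact h2.add h4⟩

theorem Balanced.neg {f : ℝ → ℝ} (hf : Balanced f) : Balanced (fun s => -f s) := by
  obtain ⟨c, h1, h2⟩ := hf
  exact ⟨-c, h1.neg, h2.neg⟩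

/-! ### The balanced primitive: derivative and limits -/

section primitive
variable {f : ℝ → ℝ}

theorem balancedPrimitive_eq (hf : Integrable f) (s : ℝ) :
    balancedPrimitive f s = (∫ t in Set.Iic s, f t) - (1 / 2) * ∫ t, f t := by
  rw [balancedPrimitive, ← intervalIntegral.integral_Iic_add_Ioi (b := s) hf.integrableOn hf.integrableOn]
  ring

theorem hasDerivAt_balancedPrimitive (hf : Integrable f) (hc : Continuous f) (s : ℝ) :
    HasDerivAt (balancedPrimitive f) (f s) s := by
  have h : balancedPrimitive f = fun s => (∫ t in (0 : ℝ)..s, f t) +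
      ((∫ t in Set.Iic (0 : ℝ), f t) - (1 / 2) * ∫ t, f t) := by
    funext s
    rw [balancedPrimitive_eq hf, ← intervalIntegral.integral_Iic_sub_Iic hf.integrableOn hf.integrableOn]
    ring
  rw [h]
  exact (intervalIntegral.integral_hasDerivAt_right (hf.intervalIntegrable)
    (hc.stronglyMeasurableAtFilter _ _) hc.continuousAt).add_const _

theorem balanced_balancedPrimitive (hf : Integrable f) : Balanced (balancedPrimitive f) := by
  refine ⟨(1 / 2) * ∫ t, f t, ?_, ?_⟩
  · have h := ((aecover_Iic (μ := volume) (tendsto_id (α := ℝ) (x := atTop))).integral_tendsto_of_countably_generated hf).sub_const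
      ((1 / 2) * ∫ t, f t)
    refine (h.congr fun s => (balancedPrimitive_eq hf s).symm).trans_eq ?_
    congr 1; ring
  · have h := ((aecover_Ioi (μ := volume) (tendsto_id (α := ℝ) (x := atBot))).integral_tendsto_of_countably_generated hf).const_sub
      ((1 / 2) * ∫ t, f t)
    refine (h.congr fun s => ?_).trans_eq ?_
    · rw [balancedPrimitive_eq hf, ← intervalIntegral.integral_Iic_add_Ioi (b := s) hf.integrableOn hf.integrableOn]
      simp only [id]; ring
    · congr 1; ring

end primitive

namespace FrenetData
variable {κ τ : ℝ → ℝ}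

theorem kappa_polyBounded (F : FrenetData κ τ) : PolyBounded κ := by
  obtain ⟨C, h⟩ := F.decay 0
  exact .of_bound C (by simpa using h)

theorem deriv_kappa (F : FrenetData κ τ) :
    deriv κ = fun s => κ s * ((κ s)⁻¹ * deriv κ s) := by
  funext s
  rw [mul_inv_cancel_left₀ (F.ne_zero s)]

theorem kappa_tame (F : FrenetData κ τ) : Tame κ := by
  intro n
  induction n with
  | zero => exact F.kappa_polyBounded
  | succ n ih =>
    refine ⟨F.kappa_polyBounded, F.differentiable, ?_⟩
    rw [F.deriv_kappa]
    exact ih.mul (F.logDeriv_tame n)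

end FrenetData

/-! ### Calculus and decay in the graded spaces -/

namespace Graded
variable {κ τ f g : ℝ → ℝ} {n m : ℤ}

theorem of_tame (hf : Tame f) : Graded κ 0 f := ⟨f, hf, by simp⟩

theorem kappa : Graded κ 1 κ := ⟨_, .const 1, by simp⟩

theorem kappaInv : Graded κ (-1) (fun s => (κ s)⁻¹) := ⟨_, .const 1, by simp⟩

theorem add (hf : Graded κ n f) (hg : Graded κ n g) : Graded κ n (fun s => f s + g s) := by
  obtain ⟨p, hp, rfl⟩ := hf
  obtain ⟨q, hq, rfl⟩ := hg
  exact ⟨_, hp.add hq, by funext s; ring⟩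

theorem mul (F : FrenetData κ τ) (hf : Graded κ n f) (hg : Graded κ m g) :
    Graded κ (n + m) (fun s => f s * g s) := by
  obtain ⟨p, hp, rfl⟩ := hf
  obtain ⟨q, hq, rfl⟩ := hg
  exact ⟨_, hp.mul hq, by funext s; rw [zpow_add₀ (F.ne_zero s)]; ring⟩

theorem smul (c : ℝ) (hf : Graded κ n f) : Graded κ n (fun s => c * f s) := by
  obtain ⟨p, hp, rfl⟩ := hf
  exact ⟨_, (Tame.const c).mul hp, by funext s; ring⟩

theorem hasDerivAt_zpow_mul (F : FrenetData κ τ) {p : ℝ → ℝ} (hp : Tame p) (s : ℝ) :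
    HasDerivAt (fun s => κ s ^ n * p s)
      (κ s ^ n * (n * (((κ s)⁻¹ * deriv κ s) * p s) + deriv p s)) s := by
  convert! (HasDerivAt.comp s (hasDerivAt_zpow n (κ s) (Or.inl (F.ne_zero s)))
    (F.differentiable s).hasDerivAt).mul (hp.differentiable s).hasDerivAt using 1
  rw [zpow_sub_one₀ (F.ne_zero s)]
  simp only [Function.comp]
  ring

/-- Differentiation does not lower the exponent of κ, because the logarithmic derivative κ'/κ is
tame. -/
theorem differentiable (F : FrenetData κ τ) (hf : Graded κ n f) : Differentiable ℝ f := by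
  obtain ⟨p, hp, rfl⟩ := hf
  exact fun s => (hasDerivAt_zpow_mul F hp s).differentiableAt

theorem deriv (F : FrenetData κ τ) (hf : Graded κ n f) : Graded κ n (deriv f) := by
  obtain ⟨p, hp, rfl⟩ := hf
  refine ⟨_, ((Tame.const n).mul (F.logDeriv_tame.mul hp)).add hp.deriv, ?_⟩
  funext s
  exact (hasDerivAt_zpow_mul F hp s).deriv

theorem weaken (F : FrenetData κ τ) (hf : Graded κ n f) : Graded κ (n - 1) f := by
  obtain ⟨p, hp, rfl⟩ := hf
  refine ⟨_, F.kappa_tame.mul hp, ?_⟩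
  funext s
  rw [zpow_sub_one₀ (F.ne_zero s)]
  field_simp [F.ne_zero s]

theorem bound (F : FrenetData κ τ) (hf : Graded κ 1 f) :
    ∃ C : ℝ, ∀ s, |f s| ≤ C * (1 + s ^ 2)⁻¹ := by
  obtain ⟨p, hp, rfl⟩ := hf
  obtain ⟨D, k, hD, h⟩ := (hp 0).polyBounded.exists_nonneg
  -- The power k absorbs the growth of p; the additional factor leaves an integrable majorant.
  obtain ⟨C, hC⟩ := F.decay (k + 1)
  refine ⟨D * C, fun s => ?_⟩
  have h0 : 0 < 1 + s ^ 2 := by positivity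
  rw [← div_eq_mul_inv, le_div_iff₀ h0]
  simp only [zpow_one, abs_mul]
  calc |κ s| * |p s| * (1 + s ^ 2) ≤ |κ s| * (D * (1 + s ^ 2) ^ k) * (1 + s ^ 2) := by
        gcongr; exact h s
    _ = D * (|κ s| * (1 + s ^ 2) ^ (k + 1)) := by ring
    _ ≤ D * C := by gcongr; exact hC s

theorem integrable (F : FrenetData κ τ) (hf : Graded κ 1 f) : Integrable f := by
  obtain ⟨C, hC⟩ := hf.bound F
  exact (integrable_inv_one_add_sq.const_mul C).mono'
    (hf.differentiable F).continuous.aestronglyMeasurable (.of_forall hC)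

theorem tendsto_zero (F : FrenetData κ τ) (hf : Graded κ 1 f) {l : Filter ℝ}
    (hl : Tendsto (fun s : ℝ => |s|) l atTop) : Tendsto f l (𝓝 0) := by
  obtain ⟨C, hC⟩ := hf.bound F
  refine squeeze_zero_norm (fun s => hC s) ?_
  have h2 : Tendsto (fun s : ℝ => 1 + s ^ 2) l atTop := by
    refine tendsto_atTop_add_const_left _ _ ?_
    simpa [Function.comp_def] using (tendsto_pow_atTop (α := ℝ) two_ne_zero).comp hl
  simpa using h2.inv_tendsto_atTop.const_mul C

theorem balanced (F : FrenetData κ τ) (hf : Graded κ 1 f) : Balanced f :=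
  ⟨0, hf.tendsto_zero F tendsto_abs_atTop_atTop, by
    simpa using hf.tendsto_zero F tendsto_abs_atBot_atTop⟩

theorem integral_deriv (F : FrenetData κ τ) (hf : Graded κ 1 f) :
    ∫ s, _root_.deriv f s = 0 := by
  simpa using integral_of_hasDerivAt_of_tendsto (fun s => (hf.differentiable F s).hasDerivAt)
    ((hf.deriv F).integrable F) (hf.tendsto_zero F tendsto_abs_atBot_atTop)
    (hf.tendsto_zero F tendsto_abs_atTop_atTop)

/-- The primitive is bounded by ∫|f|, and its derivative f = κp is tame; it need not decay, which is
why its degree is only 0. -/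
theorem balancedPrimitive (F : FrenetData κ τ) (hf : Graded κ 1 f) :
    Graded κ 0 (balancedPrimitive f) := by
  have hd := hasDerivAt_balancedPrimitive (hf.integrable F) (hf.differentiable F).continuous
  have hb : PolyBounded (VortexFilament.balancedPrimitive f) := by
    refine .of_bound (∫ t, |f t|) fun s => ?_
    have h1 : |∫ t in Set.Iic s, f t| ≤ ∫ t, |f t| :=
      (abs_integral_le_integral_abs).trans
        (setIntegral_le_integral (hf.integrable F).abs (.of_forall fun _ => abs_nonneg _))
    have h2 : |∫ t in Set.Ioi s, f t| ≤ ∫ t, |f t| :=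
      (abs_integral_le_integral_abs).trans
        (setIntegral_le_integral (hf.integrable F).abs (.of_forall fun _ => abs_nonneg _))
    rw [VortexFilament.balancedPrimitive, abs_mul, abs_of_pos one_half_pos]
    have := abs_sub (∫ t in Set.Iic s, f t) (∫ t in Set.Ioi s, f t)
    linarith
  refine of_tame (.of_deriv hb (fun s => (hd s).differentiableAt) ?_)
  rw [show _root_.deriv (VortexFilament.balancedPrimitive f) = f from funext fun s => (hd s).deriv]
  obtain ⟨p, hp, rfl⟩ := hf
  simpa using F.kappa_tame.mul hp

end Graded

/-! ### The Frenet data of a balanced asymptotically linear curve -/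

theorem contDiff_cross {f g : ℝ → E3} {n : WithTop ℕ∞} (hf : ContDiff ℝ n f)
    (hg : ContDiff ℝ n g) : ContDiff ℝ n (fun s => cross (f s) (g s)) := by
  rw [contDiff_euclidean] at hf hg ⊢
  intro i
  fin_cases i <;>
  simpa [cross, cross_apply] using ((hf _).mul (hg _)).sub ((hf _).mul (hg _))

section smooth
variable {γ : ℝ → E3}

theorem contDiff_deriv {E : Type*} [NormedAddCommGroup E] [NormedSpace ℝ E] {f : ℝ → E}
    (hf : ContDiff ℝ (⊤ : ℕ∞) f) : ContDiff ℝ (⊤ : ℕ∞) (deriv f) :=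
  (contDiff_infty_iff_deriv.1 hf).2

theorem contDiff_deriv_tangent (h : IsArclengthCurve γ) :
    ContDiff ℝ (⊤ : ℕ∞) (deriv (tangent γ)) := contDiff_deriv (contDiff_deriv h.smooth)

theorem contDiff_curvature (h : IsArclengthCurve γ) (hκ : ∀ s, curvature γ s ≠ 0) :
    ContDiff ℝ (⊤ : ℕ∞) (curvature γ) :=
  (contDiff_deriv_tangent h).norm ℝ fun s => norm_ne_zero_iff.1 (hκ s)

theorem contDiff_normal (h : IsArclengthCurve γ) (hκ : ∀ s, curvature γ s ≠ 0) :
    ContDiff ℝ (⊤ : ℕ∞) (normal γ) :=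
  ((contDiff_curvature h hκ).inv hκ).smul (contDiff_deriv_tangent h)

theorem contDiff_torsion (h : IsArclengthCurve γ) (hκ : ∀ s, curvature γ s ≠ 0) :
    ContDiff ℝ (⊤ : ℕ∞) (torsion γ) :=
  (contDiff_deriv (contDiff_normal h hκ)).inner ℝ
    (contDiff_cross (contDiff_deriv h.smooth) (contDiff_normal h hκ))

theorem differentiable_iteratedDeriv_of_contDiff {f : ℝ → ℝ} (hf : ContDiff ℝ (⊤ : ℕ∞) f)
    (k : ℕ) : Differentiable ℝ (iteratedDeriv k f) :=
  hf.differentiable_iteratedDeriv k (by exact_mod_cast ENat.natCast_lt_top k)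

end smooth

theorem RapidlyDecreasing.decay {f : ℝ → ℝ} (h : RapidlyDecreasing f) (hc : Continuous f)
    (k : ℕ) : ∃ C : ℝ, ∀ s, |f s| * (1 + s ^ 2) ^ k ≤ C := by
  have h0 := (h ((1 + X ^ 2) ^ k)).abs
  rw [← cocompact_eq_atBot_atTop, abs_zero] at h0
  obtain ⟨K, hK, hKs⟩ := mem_cocompact.1 (h0.eventually (ge_mem_nhds one_pos))
  have hc' : Continuous fun s => f s * (1 + s ^ 2) ^ k := by fun_prop
  obtain ⟨C, hC⟩ := hK.exists_bound_of_continuousOn hc'.continuousOn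
  refine ⟨max C 1, fun s => ?_⟩
  have e : |f s| * (1 + s ^ 2) ^ k = |f s * (1 + s ^ 2) ^ k| := by
    rw [abs_mul, abs_of_nonneg (a := (1 + s ^ 2) ^ k) (by positivity)]
  rw [e]
  by_cases hs : s ∈ K
  · exact (hC s hs).trans (le_max_left _ _)
  · refine le_trans ?_ (le_max_right _ _)
    simpa using hKs hs

theorem tame_of_iteratedDeriv {f : ℝ → ℝ} (hf : ContDiff ℝ (⊤ : ℕ∞) f)
    (h : ∀ k, AsympPolyLike (iteratedDeriv k f)) : Tame f := by
  have key : ∀ n k, TameOrder n (iteratedDeriv k f) := by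
    intro n
    induction n with
    | zero =>
      exact fun k => .of_asympPolyLike (h k)
        (differentiable_iteratedDeriv_of_contDiff hf k).continuous
    | succ n ih =>
      refine fun k => ⟨.of_asympPolyLike (h k)
        (differentiable_iteratedDeriv_of_contDiff hf k).continuous,
        differentiable_iteratedDeriv_of_contDiff hf k, ?_⟩
      rw [← iteratedDeriv_succ]
      exact ih (k + 1)
  intro n
  simpa using key n 0

/-- The quotients q_k = f⁻¹ f⁽ᵏ⁾ form a family closed under differentiation up to products, q_k' =
q_(k+1) − q_1 q_k, so all of them are treated in one induction. -/
theorem tame_logDeriv {f : ℝ → ℝ} (hf : ContDiff ℝ (⊤ : ℕ∞) f) (h0 : ∀ s, f s ≠ 0)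
    (h : ∀ k, AsympPolyLike fun s => (f s)⁻¹ * iteratedDeriv k f s) :
    Tame fun s => (f s)⁻¹ * deriv f s := by
  have hd : ∀ k, Differentiable ℝ fun s => (f s)⁻¹ * iteratedDeriv k f s := fun k =>
    ((hf.differentiable (by simp)).inv h0).mul (differentiable_iteratedDeriv_of_contDiff hf k)
  have key : ∀ n k, TameOrder n fun s => (f s)⁻¹ * iteratedDeriv k f s := by
    intro n
    induction n with
    | zero => exact fun k => .of_asympPolyLike (h k) (hd k).continuous
    | succ n ih =>
      refine fun k => ⟨.of_asympPolyLike (h k) (hd k).continuous, hd k, ?_⟩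
      convert (ih (k + 1)).add ((TameOrder.const (-1) n).mul ((ih 1).mul (ih k))) using 1
      funext s
      have e1 := (((hf.differentiable (by simp)) s).hasDerivAt.inv (h0 s)).mul
        (differentiable_iteratedDeriv_of_contDiff hf k s).hasDerivAt
      rw [show (fun s => (f s)⁻¹ * iteratedDeriv k f s) = f⁻¹ * iteratedDeriv k f from rfl,
        e1.deriv, ← iteratedDeriv_succ, iteratedDeriv_one]
      simp only [Pi.inv_apply]
      field_simp [h0 s]
      ring
  intro n
  simpa [iteratedDeriv_one] using key n 1

theorem IsBAL.frenetData {γ₀ γ : ℝ → E3} (h : IsBAL γ₀ γ) :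
    FrenetData (curvature γ) (torsion γ) := by
  have hκ := contDiff_curvature h.arclength h.curvature_ne_zero
  exact
    { ne_zero := h.curvature_ne_zero
      decay := h.curvature_rapid.decay hκ.continuous
      differentiable := hκ.differentiable (by simp)
      logDeriv_tame := tame_logDeriv hκ h.curvature_ne_zero h.curvature_poly
      tau_tame := tame_of_iteratedDeriv (contDiff_torsion h.arclength h.curvature_ne_zero)
        h.torsion_poly }

/-! ### Values of closed expressions along a curve -/

/-- The function of the parameter denoted by a closed expression along a curve. -/
def Expr.along {γ₀ : ℝ → E3} (e : ClosedExpr) (γ : BAL γ₀) : ℝ → ℝ := e.val γ₀ γ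

section along
variable {γ₀ : ℝ → E3} (γ : BAL γ₀) (a b : ClosedExpr) (c : ℝ)

theorem along_kappa : Expr.kappa.along γ = curvature γ.1 := rfl
theorem along_tau : Expr.tau.along γ = torsion γ.1 := rfl
theorem along_arc : Expr.arc.along γ = fun s => s := rfl
theorem along_kappaInv : Expr.kappaInv.along γ = fun s => (curvature γ.1 s)⁻¹ := rfl
theorem along_add : (a + b).along γ = fun s => a.along γ s + b.along γ s := rfl
theorem along_mul : (a * b).along γ = fun s => a.along γ s * b.along γ s := rfl
theorem along_smul : (Expr.smul c a).along γ = fun s => c * a.along γ s := rfl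
theorem along_neg : (-a).along γ = fun s => -a.along γ s := by
  funext s
  exact neg_one_mul _
theorem along_sub : (a - b).along γ = fun s => a.along γ s - b.along γ s := by
  funext s
  exact (congrArg (a.along γ s + ·) (neg_one_mul _)).trans (sub_eq_add_neg _ _).symm
theorem along_ds : (Expr.ds a).along γ = deriv (a.along γ) := rfl
theorem along_dsInv : (Expr.dsInv a).along γ = balancedPrimitive (a.along γ) := rfl

theorem Expr.Mem.graded {e : ClosedExpr} {n : ℤ} (h : e.Mem n) :
    Graded (curvature γ.1) n (e.along γ) := by
  have F := γ.2.frenetData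
  induction h with
  | var i => exact i.elim
  | kappa => exact .kappa
  | kappaInv => exact .kappaInv
  | tau => exact .of_tame F.tau_tame
  | arc => exact .of_tame .id
  | ell => exact .of_tame (.const _)
  | one => exact .of_tame (.const _)
  | add _ _ ih ih' => exact ih.add ih'
  | smul c _ ih => exact ih.smul c
  | mul _ _ ih ih' => exact ih.mul F ih'
  | ds _ ih => exact ih.deriv F
  | dsInv _ ih => exact (ih.weaken F).balancedPrimitive F
  | int _ ih => exact .of_tame (.const _)
  | weaken _ ih => exact ih.weaken F

variable {a}

theorem Expr.Mem.hasDerivAt {n : ℤ} (h : a.Mem n) (s : ℝ) :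
    HasDerivAt (a.along γ) ((Expr.ds a).along γ s) s :=
  ((Expr.Mem.graded γ h).differentiable γ.2.frenetData s).hasDerivAt

theorem Expr.Mem.graded_one (h : a.Mem 2) : Graded (curvature γ.1) 1 (a.along γ) :=
  (Expr.Mem.graded γ h).weaken γ.2.frenetData

theorem Expr.Mem.integrable (h : a.Mem 2) : Integrable (a.along γ) :=
  (Expr.Mem.graded_one γ h).integrable γ.2.frenetData

theorem along_ds_dsInv (h : a.Mem 2) : (Expr.ds (.dsInv a)).along γ = a.along γ := by
  have h1 := Expr.Mem.graded_one γ h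
  funext s
  exact (hasDerivAt_balancedPrimitive (h1.integrable γ.2.frenetData)
    (h1.differentiable γ.2.frenetData).continuous s).deriv

theorem balanced_along_dsInv (h : a.Mem 2) : Balanced ((Expr.dsInv a).along γ) :=
  balanced_balancedPrimitive (Expr.Mem.integrable γ h)

end along

/-! ### A linear functional extending the integral -/

/-- A linear extension of the integral to all functions lets identities between sums of integrals be
proved by comparing integrands pointwise. Integrability is then needed only to return to actual
integrals and to integrate derivatives. -/
theorem exists_linear_integral :
    ∃ I : (ℝ → ℝ) →ₗ[ℝ] ℝ, ∀ f, Integrable f → I f = ∫ s, f s := by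
  let S : Submodule ℝ (ℝ → ℝ) :=
    { carrier := {f | Integrable f volume}
      add_mem' := by
        intro f g hf hg
        rw [Set.mem_ofPred_eq] at hf hg ⊢
        exact hf.add hg
      zero_mem' := integrable_zero _ _ volume
      smul_mem' := by
        intro c f hf
        rw [Set.mem_ofPred_eq] at hf ⊢
        exact hf.smul c }
  let J : S →ₗ[ℝ] ℝ :=
    { toFun := fun f => ∫ s, f.1 s
      map_add' := fun f g => integral_add f.2 g.2
      map_smul' := fun c f => integral_const_mul c _ }
  obtain ⟨I, hI⟩ := J.exists_extend
  exact ⟨I, fun f hf => LinearMap.congr_fun hI ⟨f, hf⟩⟩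

/-- A linear functional on all functions that agrees with the integral on integrable ones. -/
def totalIntegral : (ℝ → ℝ) →ₗ[ℝ] ℝ := exists_linear_integral.choose

theorem totalIntegral_eq {f : ℝ → ℝ} (hf : Integrable f) : totalIntegral f = ∫ s, f s :=
  exists_linear_integral.choose_spec f hf

theorem Graded.totalIntegral_deriv {κ τ f : ℝ → ℝ} (F : FrenetData κ τ) (hf : Graded κ 1 f) :
    totalIntegral (_root_.deriv f) = 0 := by
  rw [totalIntegral_eq ((hf.deriv F).integrable F), hf.integral_deriv F]

/-! ### Rules for the variational derivative -/

section variation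
variable (X : NormalExpr Empty) (a b : ClosedExpr)

theorem variation_add : variation X (a + b) = variation X a + variation X b := rfl
theorem variation_mul : variation X (a * b) = variation X a * b + a * variation X b := rfl
theorem variation_neg : variation X (-a) = -variation X a := rfl

end variation

/-! ### Frenet components of ∇_s and of Δ_X along a curve -/

section nabla
variable {γ₀ : ℝ → E3} (γ : BAL γ₀)

theorem along_nabla_t (Z : TangentExpr Empty) (s : ℝ) : (nabla Z).t.along γ s =
    (Expr.ds Z.t).along γ s - curvature γ.1 s * Z.n.along γ s := by
  simp only [nabla, along_sub, along_mul, along_kappa]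

theorem along_nabla_n (Z : TangentExpr Empty) (s : ℝ) : (nabla Z).n.along γ s =
    curvature γ.1 s * Z.t.along γ s + (Expr.ds Z.n).along γ s
      - torsion γ.1 s * Z.b.along γ s := by
  simp only [nabla, along_sub, along_add, along_mul, along_kappa, along_tau]

theorem along_nabla_b (Z : TangentExpr Empty) (s : ℝ) : (nabla Z).b.along γ s =
    torsion γ.1 s * Z.n.along γ s + (Expr.ds Z.b).along γ s := by
  simp only [nabla, along_add, along_mul, along_tau]

theorem TangentExpr.Mem.hasDerivAt_t {Z : TangentExpr Empty} (h : Z.Mem) (s : ℝ) :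
    HasDerivAt (Z.t.along γ) ((nabla Z).t.along γ s + curvature γ.1 s * Z.n.along γ s) s := by
  rw [along_nabla_t, sub_add_cancel]
  exact Expr.Mem.hasDerivAt γ h.t_mem s

theorem TangentExpr.Mem.hasDerivAt_n {Z : TangentExpr Empty} (h : Z.Mem) (s : ℝ) :
    HasDerivAt (Z.n.along γ) ((nabla Z).n.along γ s - curvature γ.1 s * Z.t.along γ s
      + torsion γ.1 s * Z.b.along γ s) s := by
  rw [along_nabla_n]
  convert Expr.Mem.hasDerivAt γ h.n_mem s using 1
  ring

theorem TangentExpr.Mem.hasDerivAt_b {Z : TangentExpr Empty} (h : Z.Mem) (s : ℝ) :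
    HasDerivAt (Z.b.along γ) ((nabla Z).b.along γ s - torsion γ.1 s * Z.n.along γ s) s := by
  rw [along_nabla_b, add_sub_cancel_left]
  exact Expr.Mem.hasDerivAt γ h.b_mem s

theorem wp_n (X : NormalExpr Empty) : (wp X).n = X.n := rfl
theorem wp_b (X : NormalExpr Empty) : (wp X).b = X.b := rfl

variable {X Y : NormalExpr Empty}

theorem kappa_mul_n_mem (hX : X.IsVectorField) : (Expr.kappa * X.n : ClosedExpr).Mem 2 :=
  Expr.HasDegree.mul' .kappa hX.n_mem (by norm_num)

/-- The tangential component of ℘X is chosen as a primitive of κ⟨N,X⟩ so that the variation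
preserves arclength. -/
theorem along_nabla_wp_t (hX : X.IsVectorField) (s : ℝ) : (nabla (wp X)).t.along γ s = 0 := by
  rw [along_nabla_t]
  change (Expr.ds (.dsInv (.kappa * X.n))).along γ s - _ = 0
  rw [along_ds_dsInv γ (kappa_mul_n_mem hX), along_mul, along_kappa, wp_n, sub_self]

theorem along_variation_nabla_wp_t (hX : X.IsVectorField) (hY : Y.IsVectorField) (s : ℝ) :
    (variation X (nabla (wp Y)).t).along γ s = 0 := by
  change (Expr.ds (.dsInv (variation X (.kappa * Y.n))) - variation X (.kappa * Y.n)).along γ s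
    = 0
  rw [along_sub, along_ds_dsInv γ (variation_mem hX (kappa_mul_n_mem hY))]
  exact sub_self _

theorem along_deltaKappa (X : NormalExpr Empty) :
    (deltaKappa X).along γ = (nabla (nabla (wp X))).n.along γ := rfl

theorem kappa_mul_frameRotation (X : NormalExpr Empty) (s : ℝ) :
    curvature γ.1 s * (frameRotation X).along γ s = (nabla (nabla (wp X))).b.along γ s := by
  rw [frameRotation, along_mul, along_kappaInv]
  exact mul_inv_cancel_left₀ (γ.2.curvature_ne_zero s) _

theorem mem_zero_of_two {e : ClosedExpr} (h : e.Mem 2) : e.Mem 0 :=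
  Expr.HasDegree.cast (.weaken (.weaken h)) (by norm_num)

theorem tangentVariation_mem (hX : X.IsVectorField) {Z : TangentExpr Empty} (h : Z.Mem) :
    (tangentVariation X Z).Mem where
  t_mem := Expr.HasDegree.sub (Expr.HasDegree.sub (variation_mem hX h.t_mem)
      (mem_zero_of_two (.mul h.n_mem (nabla_mem (wp_mem hX)).n_mem)))
    (mem_zero_of_two (.mul h.b_mem (nabla_mem (wp_mem hX)).b_mem))
  n_mem := Expr.HasDegree.sub (.add (variation_mem hX h.n_mem)
      (Expr.HasDegree.mul' h.t_mem (nabla_mem (wp_mem hX)).n_mem (by norm_num)))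
    (Expr.HasDegree.mul' h.b_mem (frameRotation_mem hX) (by norm_num))
  b_mem := .add (.add (variation_mem hX h.b_mem)
      (Expr.HasDegree.mul' h.t_mem (nabla_mem (wp_mem hX)).b_mem (by norm_num)))
    (Expr.HasDegree.mul' h.n_mem (frameRotation_mem hX) (by norm_num))

variable (X)

theorem along_tangentVariation_t (Z : TangentExpr Empty) (s : ℝ) :
    (tangentVariation X Z).t.along γ s = (variation X Z.t).along γ s
      - Z.n.along γ s * (nabla (wp X)).n.along γ s
      - Z.b.along γ s * (nabla (wp X)).b.along γ s := by
  simp only [tangentVariation, along_sub, along_mul]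

theorem along_tangentVariation_n (Z : TangentExpr Empty) (s : ℝ) :
    (tangentVariation X Z).n.along γ s = (variation X Z.n).along γ s
      + Z.t.along γ s * (nabla (wp X)).n.along γ s
      - Z.b.along γ s * (frameRotation X).along γ s := by
  simp only [tangentVariation, along_add, along_sub, along_mul]

theorem along_tangentVariation_b (Z : TangentExpr Empty) (s : ℝ) :
    (tangentVariation X Z).b.along γ s = (variation X Z.b).along γ s
      + Z.t.along γ s * (nabla (wp X)).b.along γ s
      + Z.n.along γ s * (frameRotation X).along γ s := by
  simp only [tangentVariation, along_add, along_mul]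

end nabla

section
variable {γ₀ : ℝ → E3} (γ : BAL γ₀)

/-! ### The variational derivative commutes with `∇_s` -/

section commutation
variable {X : NormalExpr Empty} {Z : TangentExpr Empty}

/-- Δ_X commutes with ∇_s, here and in the next two lemmas: Δ_X rotates the frame infinitesimally,
and the formulas for δκ and δτ are those for which the Frenet equations stay valid under this
rotation. -/
theorem along_tangentVariation_nabla_t (hX : X.IsVectorField) (hZ : Z.Mem) (s : ℝ) :
    (tangentVariation X (nabla Z)).t.along γ s = (nabla (tangentVariation X Z)).t.along γ s := by
  have hw := nabla_mem (wp_mem hX)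
  have e : (Expr.ds (tangentVariation X Z).t).along γ s =
      (Expr.ds (variation X Z.t)).along γ s
      - ((Expr.ds Z.n).along γ s * (nabla (wp X)).n.along γ s
        + Z.n.along γ s * (Expr.ds (nabla (wp X)).n).along γ s)
      - ((Expr.ds Z.b).along γ s * (nabla (wp X)).b.along γ s
        + Z.b.along γ s * (Expr.ds (nabla (wp X)).b).along γ s) := by
    rw [along_ds, show (tangentVariation X Z).t.along γ = _ from
      funext fun s => along_tangentVariation_t γ X Z s]
    exact (((Expr.Mem.hasDerivAt γ (variation_mem hX hZ.t_mem) s).sub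
      ((Expr.Mem.hasDerivAt γ hZ.n_mem s).mul (Expr.Mem.hasDerivAt γ hw.n_mem s))).sub
      ((Expr.Mem.hasDerivAt γ hZ.b_mem s).mul (Expr.Mem.hasDerivAt γ hw.b_mem s))).deriv
  have e1 : (variation X (nabla Z).t).along γ s = (Expr.ds (variation X Z.t)).along γ s
      - ((deltaKappa X).along γ s * Z.n.along γ s
        + curvature γ.1 s * (variation X Z.n).along γ s) := by
    change (Expr.ds (variation X Z.t) - (deltaKappa X * Z.n + .kappa * variation X Z.n)).along γ s
      = _
    simp only [along_sub, along_add, along_mul, along_kappa]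
  have k1 := kappa_mul_frameRotation γ X s
  simp only [along_tangentVariation_t, along_tangentVariation_n, along_nabla_t, e, e1,
    along_deltaKappa, along_nabla_n γ Z, along_nabla_b γ Z, along_nabla_n γ (nabla (wp X)),
    along_nabla_b γ (nabla (wp X)), along_nabla_wp_t γ hX] at k1 ⊢
  linear_combination (-Z.b.along γ s) * k1

theorem along_tangentVariation_nabla_n (hX : X.IsVectorField) (hZ : Z.Mem) (s : ℝ) :
    (tangentVariation X (nabla Z)).n.along γ s = (nabla (tangentVariation X Z)).n.along γ s := by
  have hw := nabla_mem (wp_mem hX)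
  have e : (Expr.ds (tangentVariation X Z).n).along γ s =
      (Expr.ds (variation X Z.n)).along γ s
      + ((Expr.ds Z.t).along γ s * (nabla (wp X)).n.along γ s
        + Z.t.along γ s * (Expr.ds (nabla (wp X)).n).along γ s)
      - ((Expr.ds Z.b).along γ s * (frameRotation X).along γ s
        + Z.b.along γ s * (Expr.ds (frameRotation X)).along γ s) := by
    rw [along_ds, show (tangentVariation X Z).n.along γ = _ from
      funext fun s => along_tangentVariation_n γ X Z s]
    exact (((Expr.Mem.hasDerivAt γ (variation_mem hX hZ.n_mem) s).add
      ((Expr.Mem.hasDerivAt γ hZ.t_mem s).mul (Expr.Mem.hasDerivAt γ hw.n_mem s))).sub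
      ((Expr.Mem.hasDerivAt γ hZ.b_mem s).mul
        (Expr.Mem.hasDerivAt γ (frameRotation_mem hX) s))).deriv
  have e1 : (variation X (nabla Z).n).along γ s =
      (deltaKappa X).along γ s * Z.t.along γ s
        + curvature γ.1 s * (variation X Z.t).along γ s + (Expr.ds (variation X Z.n)).along γ s
      - (((Expr.ds (frameRotation X)).along γ s
          + curvature γ.1 s * (nabla (wp X)).b.along γ s) * Z.b.along γ s
        + torsion γ.1 s * (variation X Z.b).along γ s) := by
    change ((deltaKappa X * Z.t + .kappa * variation X Z.t) + Expr.ds (variation X Z.n)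
      - ((Expr.ds (frameRotation X) + .kappa * (nabla (wp X)).b) * Z.b
        + .tau * variation X Z.b)).along γ s = _
    simp only [along_sub, along_add, along_mul, along_kappa, along_tau]
  have k1 := kappa_mul_frameRotation γ X s
  simp only [along_tangentVariation_t, along_tangentVariation_n, along_tangentVariation_b,
    along_nabla_n γ (tangentVariation X Z), e, e1,
    along_deltaKappa, along_nabla_t γ Z, along_nabla_b γ Z,
    along_nabla_n γ (nabla (wp X)),
    along_nabla_b γ (nabla (wp X)), along_nabla_wp_t γ hX] at k1 ⊢
  ring

theorem along_tangentVariation_nabla_b (hX : X.IsVectorField) (hZ : Z.Mem) (s : ℝ) :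
    (tangentVariation X (nabla Z)).b.along γ s = (nabla (tangentVariation X Z)).b.along γ s := by
  have hw := nabla_mem (wp_mem hX)
  have e : (Expr.ds (tangentVariation X Z).b).along γ s =
      (Expr.ds (variation X Z.b)).along γ s
      + ((Expr.ds Z.t).along γ s * (nabla (wp X)).b.along γ s
        + Z.t.along γ s * (Expr.ds (nabla (wp X)).b).along γ s)
      + ((Expr.ds Z.n).along γ s * (frameRotation X).along γ s
        + Z.n.along γ s * (Expr.ds (frameRotation X)).along γ s) := by
    rw [along_ds, show (tangentVariation X Z).b.along γ = _ from
      funext fun s => along_tangentVariation_b γ X Z s]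
    exact (((Expr.Mem.hasDerivAt γ (variation_mem hX hZ.b_mem) s).add
      ((Expr.Mem.hasDerivAt γ hZ.t_mem s).mul (Expr.Mem.hasDerivAt γ hw.b_mem s))).add
      ((Expr.Mem.hasDerivAt γ hZ.n_mem s).mul
        (Expr.Mem.hasDerivAt γ (frameRotation_mem hX) s))).deriv
  have e1 : (variation X (nabla Z).b).along γ s =
      ((Expr.ds (frameRotation X)).along γ s
          + curvature γ.1 s * (nabla (wp X)).b.along γ s) * Z.n.along γ s
        + torsion γ.1 s * (variation X Z.n).along γ s
        + (Expr.ds (variation X Z.b)).along γ s := by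
    change (((Expr.ds (frameRotation X) + .kappa * (nabla (wp X)).b) * Z.n
        + .tau * variation X Z.n) + Expr.ds (variation X Z.b)).along γ s = _
    simp only [along_add, along_mul, along_kappa, along_tau]
  have k1 := kappa_mul_frameRotation γ X s
  simp only [along_tangentVariation_n, along_tangentVariation_b,
    along_nabla_b γ (tangentVariation X Z), e, e1,
    along_nabla_n γ Z, along_nabla_t γ Z, along_nabla_b γ (nabla (wp X))] at k1 ⊢
  linear_combination Z.t.along γ s * k1

end commutation

/-! ### The commutator and `℘` -/

theorem balanced_wp_t {X : NormalExpr Empty} (hX : X.IsVectorField) :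
    Balanced ((wp X).t.along γ) := balanced_along_dsInv γ (kappa_mul_n_mem hX)

/-- The variation of ∂_s⁻¹ is again a ∂_s⁻¹, and the terms from the rotation of the frame have
degree 2 and tend to zero. -/
theorem balanced_tangentVariation_wp_t {X Y : NormalExpr Empty} (hX : X.IsVectorField)
    (hY : Y.IsVectorField) : Balanced ((tangentVariation X (wp Y)).t.along γ) := by
  have hw := nabla_mem (wp_mem hX)
  have h1 : Balanced ((variation X (wp Y).t).along γ) :=
    balanced_along_dsInv γ (variation_mem hX (kappa_mul_n_mem hY))
  have h2 : (-(Y.n * (nabla (wp X)).n + Y.b * (nabla (wp X)).b) : ClosedExpr).Mem 2 :=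
    .neg (.add (.mul' hY.n_mem hw.n_mem (by norm_num)) (.mul' hY.b_mem hw.b_mem (by norm_num)))
  convert h1.add ((Expr.Mem.graded_one γ h2).balanced γ.2.frenetData) using 1
  funext s
  simp only [along_tangentVariation_t, along_neg, along_add, along_mul, wp_n, wp_b]
  ring

/-- A constant with opposite limits at the two ends is zero; this makes a balanced primitive unique.
-/
theorem Balanced.eq_zero_of_deriv {f : ℝ → ℝ} (hf : Balanced f) (h : ∀ s, HasDerivAt f 0 s)
    (s : ℝ) : f s = 0 := by
  have hc : ∀ t, f t = f s := fun t => is_const_of_deriv_eq_zero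
    (fun x => (h x).differentiableAt) (fun x => (h x).deriv) t s
  rw [show f = fun _ => f s from funext hc] at hf
  obtain ⟨c, h1, h2⟩ := hf
  have e1 := tendsto_nhds_unique h1 tendsto_const_nhds
  have e2 := tendsto_nhds_unique h2 tendsto_const_nhds
  linarith

theorem bracket_n (X Y : VField) (s : ℝ) : (bracket X Y).1.n.along γ s =
    (tangentVariation X.1 (wp Y.1)).n.along γ s
      - (tangentVariation Y.1 (wp X.1)).n.along γ s := by
  simp only [bracket, covariation, phi, along_sub]

theorem bracket_b (X Y : VField) (s : ℝ) : (bracket X Y).1.b.along γ s =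
    (tangentVariation X.1 (wp Y.1)).b.along γ s
      - (tangentVariation Y.1 (wp X.1)).b.along γ s := by
  simp only [bracket, covariation, phi, along_sub]

/-- After commuting Δ_X past ∇_s only the rotation of the frame contributes. The result is symmetric
in X and Y, so it drops out of commutators. -/
theorem along_nabla_tangentVariation_wp_t (X Y : VField) (s : ℝ) :
    (nabla (tangentVariation X.1 (wp Y.1))).t.along γ s =
      -((nabla (wp Y.1)).n.along γ s * (nabla (wp X.1)).n.along γ s
        + (nabla (wp Y.1)).b.along γ s * (nabla (wp X.1)).b.along γ s) := by
  rw [← along_tangentVariation_nabla_t γ X.2 (wp_mem Y.2), along_tangentVariation_t,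
    along_variation_nabla_wp_t γ X.2 Y.2]
  ring

/-- Both sides are balanced and have the same derivative. With `bracket_n` and `bracket_b` this says
℘[X,Y] = Δ_X℘Y − Δ_Y℘X, although ℘ is nonlocal. -/
theorem wp_bracket_t (X Y : VField) (s : ℝ) : (wp (bracket X Y).1).t.along γ s =
    (tangentVariation X.1 (wp Y.1)).t.along γ s
      - (tangentVariation Y.1 (wp X.1)).t.along γ s := by
  have hb := (((balanced_tangentVariation_wp_t γ X.2 Y.2).add
    (balanced_tangentVariation_wp_t γ Y.2 X.2).neg).add
      (balanced_wp_t γ (bracket X Y).2).neg)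
  have := hb.eq_zero_of_deriv (fun s => ?_) s
  · linarith
  · have d1 := (tangentVariation_mem X.2 (wp_mem Y.2)).hasDerivAt_t γ s
    have d2 := (tangentVariation_mem Y.2 (wp_mem X.2)).hasDerivAt_t γ s
    have d3 := (wp_mem (bracket X Y).2).hasDerivAt_t γ s
    rw [along_nabla_tangentVariation_wp_t] at d1 d2
    rw [along_nabla_wp_t γ (bracket X Y).2, wp_n, bracket_n] at d3
    refine ((d1.add d2.neg).add d3.neg).congr_deriv ?_
    ring

theorem nabla_wp_bracket_n (X Y : VField) (s : ℝ) :
    (nabla (wp (bracket X Y).1)).n.along γ s =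
      (nabla (tangentVariation X.1 (wp Y.1))).n.along γ s
        - (nabla (tangentVariation Y.1 (wp X.1))).n.along γ s := by
  have d1 := (tangentVariation_mem X.2 (wp_mem Y.2)).hasDerivAt_n γ s
  have d2 := (tangentVariation_mem Y.2 (wp_mem X.2)).hasDerivAt_n γ s
  have d3 := (wp_mem (bracket X Y).2).hasDerivAt_n γ s
  rw [wp_n, show (bracket X Y).1.n.along γ = _ from funext (bracket_n γ X Y)] at d3
  have := d3.unique (d1.sub d2)
  rw [wp_bracket_t, wp_b, bracket_b] at this
  linear_combination this

theorem nabla_wp_bracket_b (X Y : VField) (s : ℝ) :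
    (nabla (wp (bracket X Y).1)).b.along γ s =
      (nabla (tangentVariation X.1 (wp Y.1))).b.along γ s
        - (nabla (tangentVariation Y.1 (wp X.1))).b.along γ s := by
  have d1 := (tangentVariation_mem X.2 (wp_mem Y.2)).hasDerivAt_b γ s
  have d2 := (tangentVariation_mem Y.2 (wp_mem X.2)).hasDerivAt_b γ s
  have d3 := (wp_mem (bracket X Y).2).hasDerivAt_b γ s
  rw [wp_b, show (bracket X Y).1.b.along γ = _ from funext (bracket_b γ X Y)] at d3
  have := d3.unique (d1.sub d2)
  rw [wp_n, bracket_n] at this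
  linear_combination this

end

section
variable {γ₀ : ℝ → E3} (γ : BAL γ₀)

/-! ### Integration by parts for tangent fields -/

/-- The pointwise inner product of two tangent fields along a curve. -/
def TangentExpr.dot (Z W : TangentExpr Empty) (s : ℝ) : ℝ :=
  Z.t.along γ s * W.t.along γ s + Z.n.along γ s * W.n.along γ s + Z.b.along γ s * W.b.along γ s

/-- Tangent fields with balanced tangential component whose derivative along the curve decays. -/
structure TangentExpr.HasBalancedEnds (Z : TangentExpr Empty) : Prop where
  mem : Z.Mem
  balanced : Balanced (Z.t.along γ)
  nabla_t : Graded (curvature γ.1) 1 ((nabla Z).t.along γ)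

theorem hasBalancedEnds_wp (X : VField) : (wp X.1).HasBalancedEnds γ where
  mem := wp_mem X.2
  balanced := balanced_wp_t γ X.2
  nabla_t := by
    rw [show (nabla (wp X.1)).t.along γ = _ from funext (along_nabla_wp_t γ X.2)]
    exact ⟨_, .const 0, by simp⟩

theorem hasBalancedEnds_tangentVariation (X Y : VField) :
    (tangentVariation X.1 (wp Y.1)).HasBalancedEnds γ where
  mem := tangentVariation_mem X.2 (wp_mem Y.2)
  balanced := balanced_tangentVariation_wp_t γ X.2 Y.2
  nabla_t := by
    have hX := nabla_mem (wp_mem X.2)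
    have hY := nabla_mem (wp_mem Y.2)
    have h : (-((nabla (wp Y.1)).n * (nabla (wp X.1)).n + (nabla (wp Y.1)).b * (nabla (wp X.1)).b)
        : ClosedExpr).Mem 2 :=
      .neg (.add (.mul' hY.n_mem hX.n_mem (by norm_num)) (.mul' hY.b_mem hX.b_mem (by norm_num)))
    rw [show (nabla (tangentVariation X.1 (wp Y.1))).t.along γ = _ from
      funext (along_nabla_tangentVariation_wp_t γ X Y)]
    simpa only [along_neg, along_add, along_mul] using Expr.Mem.graded_one γ h

/-- The boundary term vanishes because the tangential components tend to c, d at +∞ and to −c, −d at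
−∞, so their product has the limit cd at both ends; the normal components decay. -/
theorem TangentExpr.HasBalancedEnds.totalIntegral_dot_nabla {Z W : TangentExpr Empty}
    (hZ : Z.HasBalancedEnds γ) (hW : W.HasBalancedEnds γ) :
    totalIntegral ((nabla Z).dot γ W) = -totalIntegral (Z.dot γ (nabla W)) := by
  have F := γ.2.frenetData
  have hdZ := nabla_mem hZ.mem
  have hdW := nabla_mem hW.mem
  have hd : ∀ s, HasDerivAt (Z.dot γ W) (((nabla Z).dot γ W + Z.dot γ (nabla W)) s) s := by
    intro s
    refine ((((hZ.mem.hasDerivAt_t γ s).mul (hW.mem.hasDerivAt_t γ s)).add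
      ((hZ.mem.hasDerivAt_n γ s).mul (hW.mem.hasDerivAt_n γ s))).add
      ((hZ.mem.hasDerivAt_b γ s).mul (hW.mem.hasDerivAt_b γ s))).congr_deriv ?_
    simp only [Pi.add_apply, TangentExpr.dot]
    ring
  have hi : Integrable ((nabla Z).dot γ W + Z.dot γ (nabla W)) := by
    have h1 : ((nabla Z).n * W.n + (nabla Z).b * W.b + (Z.n * (nabla W).n + Z.b * (nabla W).b)
        : ClosedExpr).Mem 2 :=
      .add (.add (.mul' hdZ.n_mem hW.mem.n_mem (by norm_num))
          (.mul' hdZ.b_mem hW.mem.b_mem (by norm_num)))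
        (.add (.mul' hZ.mem.n_mem hdW.n_mem (by norm_num))
          (.mul' hZ.mem.b_mem hdW.b_mem (by norm_num)))
    -- Tangential components need not decay, but those of ∇Z and ∇W do.
    have h2 := (hZ.nabla_t.mul F (Expr.Mem.graded γ hW.mem.t_mem)).integrable F
    have h3 := (hW.nabla_t.mul F (Expr.Mem.graded γ hZ.mem.t_mem)).integrable F
    refine ((h2.add h3).add (Expr.Mem.integrable γ h1)).congr (.of_forall fun s => ?_)
    simp only [Pi.add_apply, TangentExpr.dot, along_add, along_mul]
    ring
  obtain ⟨c, c1, c2⟩ := hZ.balanced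
  obtain ⟨d, d1, d2⟩ := hW.balanced
  have hm : (Z.n * W.n + Z.b * W.b : ClosedExpr).Mem 2 :=
    .add (.mul' hZ.mem.n_mem hW.mem.n_mem (by norm_num))
      (.mul' hZ.mem.b_mem hW.mem.b_mem (by norm_num))
  have e : ∀ s, Z.t.along γ s * W.t.along γ s + (Z.n * W.n + Z.b * W.b : ClosedExpr).along γ s
      = Z.dot γ W s := by
    intro s
    simp only [TangentExpr.dot, along_add, along_mul]
    ring
  have t1 := ((c1.mul d1).add ((Expr.Mem.graded_one γ hm).tendsto_zero F
    tendsto_abs_atTop_atTop)).congr e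
  have t2 := ((c2.mul d2).add ((Expr.Mem.graded_one γ hm).tendsto_zero F
    tendsto_abs_atBot_atTop)).congr e
  have := integral_of_hasDerivAt_of_tendsto hd hi t2 t1
  rw [← totalIntegral_eq hi, map_add] at this
  linear_combination this

/-! ### The form `Ω₀` and its variation along a curve -/

/-- The integrand `⟨J⁻¹ U, V⟩` of `Ω₀(U, V)`. -/
def pairing {ι : Type} (U V : NormalExpr ι) : Expr ι := (opJinv U).inner V

theorem pairing_mem {U V : NormalExpr Empty} (hU : U.IsVectorField) (hV : V.IsVectorField) :
    (pairing U V).Mem 2 :=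
  .add (.mul' (.neg hU.b_mem) hV.n_mem (by norm_num)) (.mul' hU.n_mem hV.b_mem (by norm_num))

theorem along_pairing (U V : NormalExpr Empty) (s : ℝ) : (pairing U V).along γ s =
    U.n.along γ s * V.b.along γ s - U.b.along γ s * V.n.along γ s := by
  simp only [pairing, NormalExpr.inner, opJinv, along_add, along_mul, along_neg]
  ring

theorem along_variation_pairing (X U V : NormalExpr Empty) (s : ℝ) :
    (variation X (pairing U V)).along γ s =
      (variation X U.n).along γ s * V.b.along γ s + U.n.along γ s * (variation X V.b).along γ s
      - (variation X U.b).along γ s * V.n.along γ s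
      - U.b.along γ s * (variation X V.n).along γ s := by
  simp only [pairing, NormalExpr.inner, opJinv, variation_add, variation_mul, variation_neg,
    along_add, along_mul, along_neg]
  ring

/-- The value `Ω₀(U, V)` at a curve. -/
def symplectic (U V : VField) : ℝ := totalIntegral ((pairing U.1 V.1).along γ)

/-- The value `X(Ω₀(U, V))` at a curve. -/
def symplecticVariation (X U V : VField) : ℝ :=
  totalIntegral ((variation X.1 (pairing U.1 V.1)).along γ)

theorem symplectic_eq (U V : VField) :
    ((Expr.int (pairing U.1 V.1)).along γ) = fun _ => symplectic γ U V := by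
  rw [symplectic, totalIntegral_eq (Expr.Mem.integrable γ (pairing_mem U.2 V.2))]
  rfl

theorem symplecticVariation_eq (X U V : VField) :
    ((variation X.1 (.int (pairing U.1 V.1))).along γ) =
      fun _ => symplecticVariation γ X U V := by
  rw [symplecticVariation,
    totalIntegral_eq (Expr.Mem.integrable γ (variation_mem X.2 (pairing_mem U.2 V.2)))]
  rfl

theorem symplectic_skew (U V : VField) : symplectic γ U V = -symplectic γ V U := by
  rw [symplectic, symplectic, ← map_neg]
  congr 1
  funext s
  simp only [Pi.neg_apply, along_pairing]
  ring

theorem symplecticVariation_skew (X U V : VField) :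
    symplecticVariation γ X U V = -symplecticVariation γ X V U := by
  rw [symplecticVariation, symplecticVariation, ← map_neg]
  congr 1
  funext s
  simp only [Pi.neg_apply, along_variation_pairing]
  ring

theorem symplectic_bracket_skew (X Y Z : VField) :
    symplectic γ (bracket X Y) Z = -symplectic γ (bracket Y X) Z := by
  rw [symplectic, symplectic, ← map_neg]
  congr 1
  funext s
  simp only [Pi.neg_apply, along_pairing, bracket_n, bracket_b]
  ring

/-! ### Self-adjointness of the recursion operator -/

theorem recursion_n (U : VField) : (recursion U).1.n = (nabla (wp U.1)).b := rfl
theorem recursion_b (U : VField) : (recursion U).1.b = -(nabla (wp U.1)).n := rfl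

/-- J⁻¹ cancels the J in R, and the missing tangential term is zero since ∇_s℘U is normal. -/
theorem symplectic_recursion_left (U V : VField) :
    symplectic γ (recursion U) V = totalIntegral ((nabla (wp U.1)).dot γ (wp V.1)) := by
  rw [symplectic]
  congr 1
  funext s
  simp only [along_pairing, recursion_n, recursion_b, along_neg, TangentExpr.dot,
    along_nabla_wp_t γ U.2, wp_n, wp_b]
  ring

/-- Product rule for ⟨∇_s℘U, ℘V⟩: the inner product is invariant under the rotation of the frame,
and Δ_X passes through ∇_s. -/
theorem symplecticVariation_recursion_left (X U V : VField) :
    symplecticVariation γ X (recursion U) V =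
      totalIntegral ((nabla (tangentVariation X.1 (wp U.1))).dot γ (wp V.1))
      + totalIntegral ((nabla (wp U.1)).dot γ (tangentVariation X.1 (wp V.1))) := by
  rw [symplecticVariation, ← map_add]
  congr 1
  funext s
  simp only [Pi.add_apply, along_variation_pairing, recursion_n, recursion_b, variation_neg,
    along_neg, TangentExpr.dot, along_nabla_wp_t γ U.2, wp_n, wp_b,
    ← along_tangentVariation_nabla_t γ X.2 (wp_mem U.2),
    ← along_tangentVariation_nabla_n γ X.2 (wp_mem U.2),
    ← along_tangentVariation_nabla_b γ X.2 (wp_mem U.2),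
    along_tangentVariation_t, along_tangentVariation_n, along_tangentVariation_b,
    along_variation_nabla_wp_t γ X.2 U.2]
  ring

theorem symplectic_recursion_symm (U V : VField) :
    symplectic γ (recursion U) V = symplectic γ U (recursion V) := by
  rw [symplectic_skew γ U, symplectic_recursion_left, symplectic_recursion_left,
    (hasBalancedEnds_wp γ U).totalIntegral_dot_nabla γ (hasBalancedEnds_wp γ V)]
  congr 2
  funext s
  simp only [TangentExpr.dot]
  ring

theorem TangentExpr.dot_comm (Z W : TangentExpr Empty) : Z.dot γ W = W.dot γ Z := by
  funext s
  simp only [TangentExpr.dot]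
  ring

theorem symplecticVariation_recursion_symm (X U V : VField) :
    symplecticVariation γ X (recursion U) V = symplecticVariation γ X U (recursion V) := by
  rw [symplecticVariation_skew γ X U, symplecticVariation_recursion_left,
    symplecticVariation_recursion_left,
    (hasBalancedEnds_tangentVariation γ X U).totalIntegral_dot_nabla γ (hasBalancedEnds_wp γ V),
    (hasBalancedEnds_tangentVariation γ X V).totalIntegral_dot_nabla γ (hasBalancedEnds_wp γ U),
    TangentExpr.dot_comm γ (nabla (wp U.1)), TangentExpr.dot_comm γ (nabla (wp V.1))]
  ring

/-! ### Closedness of `Ω₀`, `Ω₁` and `Ω₂` -/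

/-- The determinant of three tangent fields along a curve. -/
def TangentExpr.det (U V W : TangentExpr Empty) (s : ℝ) : ℝ :=
  U.t.along γ s * (V.n.along γ s * W.b.along γ s - V.b.along γ s * W.n.along γ s)
  - U.n.along γ s * (V.t.along γ s * W.b.along γ s - V.b.along γ s * W.t.along γ s)
  + U.b.along γ s * (V.t.along γ s * W.n.along γ s - V.n.along γ s * W.t.along γ s)

theorem totalIntegral_det_nabla (U V W : VField) :
    totalIntegral ((nabla (wp U.1)).det γ (wp V.1) (wp W.1)
      + (wp U.1).det γ (nabla (wp V.1)) (wp W.1)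
      + (wp U.1).det γ (wp V.1) (nabla (wp W.1))) = 0 := by
  have hU := wp_mem U.2
  have hV := wp_mem V.2
  have hW := wp_mem W.2
  -- Expanding the determinant along the tangential components makes each term a tangential
  -- component times a minor of normal ones, hence of degree 2 with no boundary contribution.
  have hm : ((wp U.1).t * ((wp V.1).n * (wp W.1).b - (wp V.1).b * (wp W.1).n)
      - (wp V.1).t * ((wp U.1).n * (wp W.1).b - (wp U.1).b * (wp W.1).n)
      + (wp W.1).t * ((wp U.1).n * (wp V.1).b - (wp U.1).b * (wp V.1).n) : ClosedExpr).Mem 2 := by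
    have aux : ∀ {a b c : TangentExpr Empty}, a.Mem → b.Mem → c.Mem →
        (a.t * (b.n * c.b - b.b * c.n) : ClosedExpr).Mem 2 := fun ha hb hc =>
      .mul' ha.t_mem (.sub (.mul hb.n_mem hc.b_mem) (.mul hb.b_mem hc.n_mem)) (by norm_num)
    exact .add (.sub (aux hU hV hW) (aux hV hU hW)) (aux hW hU hV)
  rw [← (Expr.Mem.graded_one γ hm).totalIntegral_deriv γ.2.frenetData]
  congr 1
  funext s
  symm
  refine HasDerivAt.deriv ?_
  have aux : ∀ {a b c : TangentExpr Empty}, a.Mem → b.Mem → c.Mem → _ := fun ha hb hc =>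
    (ha.hasDerivAt_t γ s).mul (((hb.hasDerivAt_n γ s).mul (hc.hasDerivAt_b γ s)).sub
      ((hb.hasDerivAt_b γ s).mul (hc.hasDerivAt_n γ s)))
  simp only [along_add, along_sub, along_mul]
  refine (((aux hU hV hW).sub (aux hV hU hW)).add (aux hW hU hV)).congr_deriv ?_
  simp only [Pi.add_apply, Pi.sub_apply, Pi.mul_apply, TangentExpr.det]
  ring

/-- The variations of components cancel against those in the commutators, and rotations within the
normal plane preserve the pairing. What remains comes from tilting the frame towards T and is the
derivative of det(℘X, ℘U, ℘V). -/
theorem symplectic_closed (X U V : VField) :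
    symplecticVariation γ X U V + symplecticVariation γ U V X + symplecticVariation γ V X U
      - symplectic γ (bracket X U) V - symplectic γ (bracket U V) X
      - symplectic γ (bracket V X) U = 0 := by
  rw [← totalIntegral_det_nabla γ X U V]
  simp only [symplectic, symplecticVariation, ← map_add, ← map_sub]
  congr 1
  funext s
  simp only [Pi.add_apply, Pi.sub_apply, along_pairing, along_variation_pairing, bracket_n,
    bracket_b, TangentExpr.det, along_tangentVariation_n, along_tangentVariation_b,
    along_nabla_wp_t γ X.2, along_nabla_wp_t γ U.2, along_nabla_wp_t γ V.2, wp_n, wp_b]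
  ring

theorem symplectic_recursion_bracket (X U V : VField) :
    symplectic γ (recursion (bracket X U)) V =
      totalIntegral ((nabla (tangentVariation X.1 (wp U.1))).dot γ (wp V.1))
      - totalIntegral ((nabla (tangentVariation U.1 (wp X.1))).dot γ (wp V.1)) := by
  rw [symplectic, ← map_sub]
  congr 1
  funext s
  simp only [Pi.sub_apply, along_pairing, recursion_n, recursion_b, along_neg, TangentExpr.dot,
    nabla_wp_bracket_n, nabla_wp_bracket_b, along_nabla_tangentVariation_wp_t, wp_n, wp_b]
  ring

/-- The surviving terms pair up as ⟨∇_s℘U, Δ_X℘V⟩ + ⟨∇_sΔ_X℘V, ℘U⟩ and its cyclic images, which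
integrate to zero by parts. -/
theorem symplectic_recursion_closed (X U V : VField) :
    symplecticVariation γ X (recursion U) V + symplecticVariation γ U (recursion V) X
      + symplecticVariation γ V (recursion X) U
      - symplectic γ (recursion (bracket X U)) V - symplectic γ (recursion (bracket U V)) X
      - symplectic γ (recursion (bracket V X)) U = 0 := by
  simp only [symplecticVariation_recursion_left, symplectic_recursion_bracket]
  rw [(hasBalancedEnds_tangentVariation γ U X).totalIntegral_dot_nabla γ (hasBalancedEnds_wp γ V),
    (hasBalancedEnds_tangentVariation γ V U).totalIntegral_dot_nabla γ (hasBalancedEnds_wp γ X),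
    (hasBalancedEnds_tangentVariation γ X V).totalIntegral_dot_nabla γ (hasBalancedEnds_wp γ U),
    TangentExpr.dot_comm γ (nabla (wp U.1)), TangentExpr.dot_comm γ (nabla (wp V.1)),
    TangentExpr.dot_comm γ (nabla (wp X.1))]
  ring

/-- No integration is needed: ⟨J⁻¹RU, RV⟩ is det(T, ∇_s℘U, ∇_s℘V), a pairing of normal fields. Since
these have no tangential part, tilting the frame contributes nothing and the integrands cancel
pointwise. -/
theorem symplectic_recursion_recursion_closed (X U V : VField) :
    symplecticVariation γ X (recursion U) (recursion V)
      + symplecticVariation γ U (recursion V) (recursion X)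
      + symplecticVariation γ V (recursion X) (recursion U)
      - symplectic γ (recursion (bracket X U)) (recursion V)
      - symplectic γ (recursion (bracket U V)) (recursion X)
      - symplectic γ (recursion (bracket V X)) (recursion U) = 0 := by
  rw [← map_zero totalIntegral]
  simp only [symplectic, symplecticVariation, ← map_add, ← map_sub]
  congr 1
  funext s
  simp only [Pi.add_apply, Pi.sub_apply, Pi.zero_apply, along_pairing, along_variation_pairing,
    recursion_n, recursion_b, variation_neg, along_neg, nabla_wp_bracket_n, nabla_wp_bracket_b,
    ← along_tangentVariation_nabla_n γ X.2 (wp_mem U.2),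
    ← along_tangentVariation_nabla_b γ X.2 (wp_mem U.2),
    ← along_tangentVariation_nabla_n γ U.2 (wp_mem X.2),
    ← along_tangentVariation_nabla_b γ U.2 (wp_mem X.2),
    ← along_tangentVariation_nabla_n γ X.2 (wp_mem V.2),
    ← along_tangentVariation_nabla_b γ X.2 (wp_mem V.2),
    ← along_tangentVariation_nabla_n γ V.2 (wp_mem X.2),
    ← along_tangentVariation_nabla_b γ V.2 (wp_mem X.2),
    ← along_tangentVariation_nabla_n γ U.2 (wp_mem V.2),
    ← along_tangentVariation_nabla_b γ U.2 (wp_mem V.2),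
    ← along_tangentVariation_nabla_n γ V.2 (wp_mem U.2),
    ← along_tangentVariation_nabla_b γ V.2 (wp_mem U.2),
    along_tangentVariation_n, along_tangentVariation_b,
    along_nabla_wp_t γ X.2, along_nabla_wp_t γ U.2, along_nabla_wp_t γ V.2]
  ring

end

/-! ### Base cases: the vector fields `a κ B` with `a` affine in `s` -/

section
variable {γ₀ : ℝ → E3} (γ : BAL γ₀)

/-- The vector field agrees with `a κ B`, up to first variations, where `a` is a function of the
parameter only. -/
structure IsKappaBMultiple (a : ℝ → ℝ) (X : VField) : Prop where
  t : ∀ s, (wp X.1).t.along γ s = 0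
  n : ∀ s, X.1.n.along γ s = 0
  b : ∀ s, X.1.b.along γ s = a s * curvature γ.1 s
  variation_t : ∀ (U : VField) s, (variation U.1 (wp X.1).t).along γ s = 0
  variation_n : ∀ (U : VField) s, (variation U.1 X.1.n).along γ s = 0
  variation_b : ∀ (U : VField) s,
    (variation U.1 X.1.b).along γ s = a s * (deltaKappa U.1).along γ s

theorem balancedPrimitive_zero (s : ℝ) : balancedPrimitive (fun _ => 0) s = 0 := by
  simp [balancedPrimitive]

theorem isKappaBMultiple_kappaB : IsKappaBMultiple γ (fun _ => 1) kappaB where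
  t s := by
    change (Expr.dsInv (.kappa * .smul 0 .kappa) : ClosedExpr).along γ s = 0
    simp only [along_dsInv, along_mul, along_smul, zero_mul, mul_zero, balancedPrimitive_zero]
  n s := by
    change (Expr.smul 0 .kappa : ClosedExpr).along γ s = 0
    simp only [along_smul, zero_mul]
  b s := (one_mul _).symm
  variation_t U s := by
    change (Expr.dsInv (deltaKappa U.1 * .smul 0 .kappa + .kappa * .smul 0 (deltaKappa U.1))
      : ClosedExpr).along γ s = 0
    simp only [along_dsInv, along_add, along_mul, along_smul, zero_mul, mul_zero, add_zero,
      balancedPrimitive_zero]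
  variation_n U s := by
    change (Expr.smul 0 (deltaKappa U.1) : ClosedExpr).along γ s = 0
    simp only [along_smul, zero_mul]
  variation_b U s := (one_mul _).symm

theorem isKappaBMultiple_arcKappaB : IsKappaBMultiple γ (fun s => s) arcKappaB where
  t := (isKappaBMultiple_kappaB γ).t
  n := (isKappaBMultiple_kappaB γ).n
  b s := rfl
  variation_t := (isKappaBMultiple_kappaB γ).variation_t
  variation_n := (isKappaBMultiple_kappaB γ).variation_n
  variation_b U s := by
    change (Expr.smul 0 .one * .kappa + .arc * deltaKappa U.1 : ClosedExpr).along γ s = _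
    simp only [along_add, along_mul, along_smul, along_arc]
    ring

variable {a : ℝ → ℝ} {X : VField} {c : ℝ}

/-- Integration by parts against an affine weight; the slope c enters the base cases only here. -/
theorem totalIntegral_mul_deriv (ha : Tame a) (hc : ∀ s, HasDerivAt a c s) {f g : ℝ → ℝ}
    (hf : Graded (curvature γ.1) 1 f) (hg : ∀ s, HasDerivAt f (g s) s) :
    totalIntegral (fun s => a s * g s) = -(c * totalIntegral f) := by
  have h : Graded (curvature γ.1) 1 (fun s => a s * f s) := by
    simpa using (Graded.of_tame ha).mul γ.2.frenetData hf
  have e := h.totalIntegral_deriv γ.2.frenetData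
  have e1 : deriv (fun s => a s * f s) = c • f + fun s => a s * g s := by
    funext s
    exact ((hc s).mul (hg s)).deriv
  rw [e1, map_add, map_smul, smul_eq_mul] at e
  linear_combination e

/-- The left side is d(ω(X, ·)), which is L_Xω by closedness. Its integrand is −a(⟨∇_s²℘U, V⟩ −
⟨∇_s²℘V, U⟩), that is, −a times the derivative of ⟨∇_s℘U, V⟩ − ⟨∇_s℘V, U⟩. -/
theorem IsKappaBMultiple.symplectic_lieDeriv (h : IsKappaBMultiple γ a X) (ha : Tame a)
    (hc : ∀ s, HasDerivAt a c s) (U V : VField) :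
    symplecticVariation γ U X V - symplecticVariation γ V X U - symplectic γ X (bracket U V)
      = 2 * c * symplectic γ (recursion U) V := by
  have hU := wp_mem U.2
  have hV := wp_mem V.2
  have hdU := nabla_mem hU
  have hdV := nabla_mem hV
  have hm : ((nabla (wp U.1)).n * (wp V.1).n + (nabla (wp U.1)).b * (wp V.1).b
      - ((nabla (wp V.1)).n * (wp U.1).n + (nabla (wp V.1)).b * (wp U.1).b) : ClosedExpr).Mem 2 :=
    .sub (.add (.mul' hdU.n_mem hV.n_mem (by norm_num)) (.mul' hdU.b_mem hV.b_mem (by norm_num)))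
      (.add (.mul' hdV.n_mem hU.n_mem (by norm_num)) (.mul' hdV.b_mem hU.b_mem (by norm_num)))
  have hd := fun s => ((((hdU.hasDerivAt_n γ s).mul (hV.hasDerivAt_n γ s)).add
      ((hdU.hasDerivAt_b γ s).mul (hV.hasDerivAt_b γ s))).sub
    (((hdV.hasDerivAt_n γ s).mul (hU.hasDerivAt_n γ s)).add
      ((hdV.hasDerivAt_b γ s).mul (hU.hasDerivAt_b γ s))))
  have key := totalIntegral_mul_deriv γ ha hc (Expr.Mem.graded_one γ hm)
    (fun s => by simpa only [along_sub, along_add, along_mul] using! hd s)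
  -- The factor 2 arises because Ω₁ is skew: R is self-adjoint for the skew form ω.
  have e1 : totalIntegral (((nabla (wp U.1)).n * (wp V.1).n + (nabla (wp U.1)).b * (wp V.1).b
      - ((nabla (wp V.1)).n * (wp U.1).n + (nabla (wp V.1)).b * (wp U.1).b)
        : ClosedExpr).along γ) = 2 * symplectic γ (recursion U) V := by
    have e2 : symplectic γ (recursion V) U = -symplectic γ (recursion U) V := by
      rw [symplectic_skew γ (recursion V), symplectic_recursion_symm]
    have e3 : (2 : ℝ) * symplectic γ (recursion U) V =
        symplectic γ (recursion U) V - symplectic γ (recursion V) U := by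
      rw [e2]; ring
    rw [e3, symplectic_recursion_left, symplectic_recursion_left, ← map_sub]
    congr 1
    funext s
    simp only [along_sub, along_add, along_mul, Pi.sub_apply, TangentExpr.dot,
      along_nabla_wp_t γ U.2, along_nabla_wp_t γ V.2]
    ring
  rw [e1] at key
  rw [show 2 * c * symplectic γ (recursion U) V = -(-(c * (2 * symplectic γ (recursion U) V)))
    by ring, ← key]
  simp only [symplectic, symplecticVariation, ← map_sub, ← map_neg]
  congr 1
  funext s
  have kU := kappa_mul_frameRotation γ U.1 s
  have kV := kappa_mul_frameRotation γ V.1 s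
  simp only [Pi.sub_apply, Pi.neg_apply, along_pairing, along_variation_pairing, h.n, h.b,
    h.variation_n, h.variation_b, bracket_n, bracket_b, along_tangentVariation_n,
    along_deltaKappa, along_nabla_wp_t γ U.2, along_nabla_wp_t γ V.2, wp_n, wp_b]
  linear_combination (a s * U.1.b.along γ s) * kV - (a s * V.1.b.along γ s) * kU

/-- The left side is d(Ω₁(X, ·)), which is L_XΩ₁ by closedness. After integration by parts its
integrand is −a times the derivative of det(T, ∇_s℘U, ∇_s℘V), the integrand of Ω₂. -/
theorem IsKappaBMultiple.symplectic_recursion_lieDeriv (h : IsKappaBMultiple γ a X)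
    (ha : Tame a) (hc : ∀ s, HasDerivAt a c s) (U V : VField) :
    symplecticVariation γ U (recursion X) V - symplecticVariation γ V (recursion X) U
      - symplectic γ (recursion X) (bracket U V)
      = c * symplectic γ (recursion U) (recursion V) := by
  have hdU := nabla_mem (wp_mem U.2)
  have hdV := nabla_mem (wp_mem V.2)
  have hm : ((nabla (wp U.1)).n * (nabla (wp V.1)).b - (nabla (wp U.1)).b * (nabla (wp V.1)).n
      : ClosedExpr).Mem 2 :=
    .sub (.mul' hdU.n_mem hdV.b_mem (by norm_num)) (.mul' hdU.b_mem hdV.n_mem (by norm_num))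
  have hd := fun s => ((hdU.hasDerivAt_n γ s).mul (hdV.hasDerivAt_b γ s)).sub
    ((hdU.hasDerivAt_b γ s).mul (hdV.hasDerivAt_n γ s))
  have key := totalIntegral_mul_deriv γ ha hc (Expr.Mem.graded_one γ hm)
    (fun s => by simpa only [along_sub, along_mul] using! hd s)
  have e1 : totalIntegral (((nabla (wp U.1)).n * (nabla (wp V.1)).b
      - (nabla (wp U.1)).b * (nabla (wp V.1)).n : ClosedExpr).along γ)
      = symplectic γ (recursion U) (recursion V) := by
    rw [symplectic]
    congr 1
    funext s
    simp only [along_sub, along_mul, along_pairing, recursion_n, recursion_b, along_neg]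
    ring
  rw [e1] at key
  rw [symplecticVariation_recursion_left, symplecticVariation_recursion_left,
    symplectic_recursion_left,
    (hasBalancedEnds_tangentVariation γ U X).totalIntegral_dot_nabla γ (hasBalancedEnds_wp γ V),
    (hasBalancedEnds_tangentVariation γ V X).totalIntegral_dot_nabla γ (hasBalancedEnds_wp γ U),
    show c * symplectic γ (recursion U) (recursion V)
      = -(-(c * symplectic γ (recursion U) (recursion V))) by ring, ← key]
  simp only [← map_sub, ← map_neg, ← map_add]
  congr 1
  funext s
  have kU := kappa_mul_frameRotation γ U.1 s
  have kV := kappa_mul_frameRotation γ V.1 s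
  simp only [Pi.sub_apply, Pi.neg_apply, Pi.add_apply, TangentExpr.dot,
    wp_bracket_t, bracket_n, bracket_b, along_nabla_wp_t γ X.2, wp_n, wp_b]
  simp only [along_tangentVariation_n γ _ (wp X.1), along_tangentVariation_b γ _ (wp X.1),
    along_nabla_wp_t γ U.2, along_nabla_wp_t γ V.2, wp_n, wp_b, h.n, h.b, h.t,
    h.variation_n, h.variation_b, along_deltaKappa]
  linear_combination (a s * (nabla (wp V.1)).n.along γ s) * kU
    - (a s * (nabla (wp U.1)).n.along γ s) * kV

end

/-! ### Compatible symplectic pairs -/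

/-- The algebraic properties of a form `ω = Ω₀`, of the derivatives `A X U V = X(ω(U, V))` and of
a recursion operator `R` such that `ω`, `ω ∘ R` and `ω ∘ R²` are closed two-forms. -/
structure IsHereditaryPair {V : Type} (br : V → V → V) (R : V → V) (ω : V → V → ℝ)
    (A : V → V → V → ℝ) : Prop where
  skew : ∀ U W, ω U W = -ω W U
  symm : ∀ U W, ω (R U) W = ω U (R W)
  variation_skew : ∀ X U W, A X U W = -A X W U
  variation_symm : ∀ X U W, A X (R U) W = A X U (R W)
  bracket_skew : ∀ X Y W, ω (br X Y) W = -ω (br Y X) W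
  closed : ∀ X U W, A X U W + A U W X + A W X U - ω (br X U) W - ω (br U W) X
    - ω (br W X) U = 0
  closed_one : ∀ X U W, A X (R U) W + A U (R W) X + A W (R X) U - ω (R (br X U)) W
    - ω (R (br U W)) X - ω (R (br W X)) U = 0
  closed_two : ∀ X U W, A X (R U) (R W) + A U (R W) (R X) + A W (R X) (R U)
    - ω (R (br X U)) (R W) - ω (R (br U W)) (R X) - ω (R (br W X)) (R U) = 0

namespace IsHereditaryPair
variable {V : Type} {br : V → V → V} {R : V → V} {ω : V → V → ℝ} {A : V → V → V → ℝ}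

/-- Comparing closedness of Ω₁ at (RX, Y, Z) and (X, RY, Z) with that of ω at (RX, RY, Z) and of Ω₂
at (X, Y, Z), all derivatives and all commutators involving Z cancel. -/
theorem nijenhuis (H : IsHereditaryPair br R ω A) (X Y Z : V) :
    ω (br (R X) (R Y)) Z - ω (br (R X) Y) (R Z) - ω (br X (R Y)) (R Z)
      + ω (br X Y) (R (R Z)) = 0 := by
  have h0 := H.closed (R X) (R Y) Z
  have h1 := H.closed_one (R X) Y Z
  have h2 := H.closed_one X (R Y) Z
  have h3 := H.closed_two X Y Z
  simp only [H.symm, H.variation_symm] at h0 h1 h2 h3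
  linear_combination h1 + h2 - h0 - h3

theorem iterate_succ (H : IsHereditaryPair br R ω A) (n : ℕ) (U W : V) :
    ω (R^[n + 1] U) W = ω (R^[n] U) (R W) := by
  rw [Function.iterate_succ_apply', H.symm]

/-- `L_X ω = c ω ∘ Rᵏ` and `L_X R = c' R^(k+1)`, the latter tested against `ω`. -/
structure Scales (br : V → V → V) (R : V → V) (ω : V → V → ℝ) (A : V → V → V → ℝ) (X : V)
    (c c' : ℝ) (k : ℕ) : Prop where
  form : ∀ U W, A X U W - ω (br X U) W - ω U (br X W) = c * ω (R^[k] U) W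
  operator : ∀ U W, ω (br X (R U)) W - ω (br X U) (R W) = c' * ω (R^[k + 1] U) W

/-- By closedness of ω and Ω₁, L_{RX}ω = d(ω(RX, ·)) = d(Ω₁(X, ·)) = L_XΩ₁ = (L_Xω)∘R + ω∘L_X R.
Vanishing torsion gives L_{RX}R = R L_X R. -/
theorem scales_recursion (H : IsHereditaryPair br R ω A) {X : V} {c c' : ℝ} {k : ℕ}
    (h : Scales br R ω A X c c' k) : Scales br R ω A (R X) (c + c') c' (k + 1) where
  form U W := by
    have h0 := H.closed (R X) U W
    have h1 := H.closed_one X U W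
    have h2 := h.form (R U) W
    have h3 := h.operator U W
    have s1 := H.variation_skew W X (R U)
    have s3 := H.skew U (br (R X) W)
    have s4 := H.skew U (R (br X W))
    have s5 := H.bracket_skew W X (R U)
    have s6 := H.bracket_skew W (R X) U
    simp only [H.symm, H.variation_symm, Function.iterate_succ_apply] at h0 h1 h2 h3 s4 ⊢
    linear_combination h0 - h1 + h2 + h3 - s3 + s4 + s6 - s5
  operator U W := by
    have h1 := H.nijenhuis X U W
    have h2 := h.operator U (R W)
    rw [H.iterate_succ]
    linear_combination h1 + h2

theorem scales_iterate (H : IsHereditaryPair br R ω A) {X : V} {c c' : ℝ} {k : ℕ}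
    (h : Scales br R ω A X c c' k) (m : ℕ) :
    Scales br R ω A (R^[m] X) (c + m * c') c' (k + m) := by
  induction m with
  | zero => simpa using h
  | succ m ih =>
    rw [Function.iterate_succ_apply']
    convert H.scales_recursion ih using 1
    · push_cast
      ring
    · rfl

theorem Scales.lieDeriv_iterate (H : IsHereditaryPair br R ω A) {X : V} {c c' : ℝ} {k : ℕ}
    (h : Scales br R ω A X c c' k) (n : ℕ) (U W : V) :
    A X (R^[n] U) W - ω (R^[n] (br X U)) W - ω (R^[n] U) (br X W)
      = (c + n * c') * ω (R^[k + n] U) W := by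
  -- The Leibniz rule for L_X Rⁿ; W stays universally quantified because each step moves one R over
  -- to it.
  have key : ∀ n W, ω (br X (R^[n] U)) W - ω (R^[n] (br X U)) W
      = n * c' * ω (R^[k + n] U) W := by
    intro n
    induction n with
    | zero => simp
    | succ n ih =>
      intro W
      have h1 := h.operator (R^[n] U) W
      have h2 := ih (R W)
      rw [← Function.iterate_succ_apply' R, ← Function.iterate_add_apply,
        show k + 1 + n = k + n + 1 by omega, H.iterate_succ] at h1
      rw [H.iterate_succ, ← Nat.add_assoc, H.iterate_succ]
      push_cast
      linear_combination h1 + h2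
  have h1 := h.form (R^[n] U) W
  rw [← Function.iterate_add_apply] at h1
  linear_combination h1 + key n W

end IsHereditaryPair

/-! ### Lie derivatives of the forms `Ωₙ` -/

section
variable {γ₀ : ℝ → E3} (γ : BAL γ₀)

theorem isHereditaryPair_symplectic :
    IsHereditaryPair bracket recursion (symplectic γ) (symplecticVariation γ) where
  skew := symplectic_skew γ
  symm := symplectic_recursion_symm γ
  variation_skew := symplecticVariation_skew γ
  variation_symm := symplecticVariation_recursion_symm γ
  bracket_skew := symplectic_bracket_skew γ
  closed := symplectic_closed γ
  closed_one := symplectic_recursion_closed γ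
  closed_two := symplectic_recursion_recursion_closed γ

/-- L_XΩ₁ = (L_Xω)∘R + ω∘L_X R reads cΩ₂ = 2cΩ₂ + ω∘L_X R, which leaves the coefficient c − 2c = −c
for L_X R. -/
theorem IsKappaBMultiple.scales {a : ℝ → ℝ} {X : VField} {c : ℝ} (h : IsKappaBMultiple γ a X)
    (ha : Tame a) (hc : ∀ s, HasDerivAt a c s) :
    IsHereditaryPair.Scales bracket recursion (symplectic γ) (symplecticVariation γ) X
      (2 * c) (-c) 1 := by
  have H := isHereditaryPair_symplectic γ
  have form : ∀ U W, symplecticVariation γ X U W - symplectic γ (bracket X U) W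
      - symplectic γ U (bracket X W) = 2 * c * symplectic γ (recursion U) W := by
    intro U W
    have h1 := h.symplectic_lieDeriv γ ha hc U W
    have h2 := H.closed X U W
    linear_combination h1 + h2 - H.variation_skew U X W - H.skew U (bracket X W)
      + H.bracket_skew W X U + H.skew X (bracket U W)
  refine ⟨form, fun U W => ?_⟩
  have h1 := h.symplectic_recursion_lieDeriv γ ha hc U W
  have h2 := H.closed_one X U W
  have h3 := form (recursion U) W
  have s2 := H.skew (recursion U) (bracket X W)
  have s3 := H.bracket_skew W X (recursion U)
  have s4 := H.variation_skew U W (recursion X)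
  have s5 := H.skew (recursion X) (bracket U W)
  simp only [Function.iterate_succ_apply, Function.iterate_zero, id, H.symm,
    H.variation_symm] at h1 h2 h3 s2 s3 s4 s5 ⊢
  linear_combination h1 + h2 - h3 - s2 + s3 - s4 + s5

theorem scales_symmetry (m : ℕ) :
    IsHereditaryPair.Scales bracket recursion (symplectic γ) (symplecticVariation γ)
      (symmetry m) 0 0 (1 + m) := by
  have h := (isKappaBMultiple_kappaB γ).scales γ (.const 1) (fun s => hasDerivAt_const s 1)
  simpa [symmetry] using (isHereditaryPair_symplectic γ).scales_iterate h m

/-- The coefficients at sκB are 2 and −1, and each of the m − 1 applications of R lowers the first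
by 1. -/
theorem scales_masterSymmetry {m : ℕ} (hm : 1 ≤ m) :
    IsHereditaryPair.Scales bracket recursion (symplectic γ) (symplecticVariation γ)
      (masterSymmetry m) (3 - m) (-1) m := by
  have h := (isKappaBMultiple_arcKappaB γ).scales γ .id (fun s => hasDerivAt_id' s)
  obtain ⟨k, rfl⟩ := Nat.exists_eq_add_of_le hm
  convert (isHereditaryPair_symplectic γ).scales_iterate h k using 1
  · rw [masterSymmetry, Nat.add_sub_cancel_left]
  · push_cast
    ring

end

/-! ### Substitution into forms -/

/-- Substitution of expressions for the variables in both components. -/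
def NormalExpr.subst {ι ι' : Type} (σ : ι → Expr ι') (X : NormalExpr ι) : NormalExpr ι' :=
  ⟨X.n.subst σ, X.b.subst σ⟩

theorem subst_opR_iterate {ι ι' : Type} (σ : ι → Expr ι') (X : NormalExpr ι) (n : ℕ) :
    (opR^[n] X).subst σ = opR^[n] (X.subst σ) := by
  induction n generalizing X with
  | zero => rfl
  | succ n ih =>
    rw [Function.iterate_succ_apply, ih, Function.iterate_succ_apply]
    rfl

theorem coe_recursion_iterate (U : VField) (n : ℕ) : (recursion^[n] U).1 = opR^[n] U.1 := by
  induction n generalizing U with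
  | zero => rfl
  | succ n ih =>
    rw [Function.iterate_succ_apply, ih, Function.iterate_succ_apply]
    rfl

theorem Omega_apply (n : ℕ) (U : Fin 2 → VField) :
    (Omega n).apply U = .int (pairing (recursion^[n] (U 0)).1 (U 1).1) := by
  have h := subst_opR_iterate
    (fun k : Fin 2 × Fin 2 => if k.2 = 0 then (U k.1).1.n else (U k.1).1.b) (argument 0) n
  rw [coe_recursion_iterate]
  exact congrArg (fun Z => Expr.int (pairing Z (U 1).1)) h

theorem Omega_apply_val {γ₀ : ℝ → E3} (n : ℕ) (U : Fin 2 → VField) (γ : BAL γ₀) (s : ℝ) :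
    ((Omega n).apply U).val γ₀ γ s = symplectic γ (recursion^[n] (U 0)) (U 1) := by
  rw [Omega_apply]
  exact congrFun (symplectic_eq γ _ _) s

theorem lieDeriv_Omega {γ₀ : ℝ → E3} (X : VField) (n : ℕ) (U : Fin 2 → VField) (γ : BAL γ₀)
    (s : ℝ) : lieDeriv γ₀ X (Omega n) U γ s =
      symplecticVariation γ X (recursion^[n] (U 0)) (U 1)
        - symplectic γ (recursion^[n] (bracket X (U 0))) (U 1)
        - symplectic γ (recursion^[n] (U 0)) (bracket X (U 1)) := by
  rw [lieDeriv, Fin.sum_univ_two, Omega_apply n U]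
  simp only [Pi.sub_apply, Pi.add_apply, Omega_apply_val]
  rw [show (variation X.1 (.int (pairing (recursion^[n] (U 0)).1 (U 1).1))).val γ₀ γ s = _ from
    congrFun (symplecticVariation_eq γ X _ _) s]
  simp [Function.update]
  ring

/-- Substitution along `Empty.elim` regards a closed expression as one in which no variable occurs;
a fixed vector field thereby becomes a coefficient of a form. -/
theorem subst_subst_closed {ι : Type} (σ : ι → ClosedExpr) (e : ClosedExpr) :
    (e.subst (Empty.elim : Empty → Expr ι)).subst σ = e := by
  induction e with
  | var i => exact i.elim
  | _ => simp_all [Expr.subst]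

theorem eval_subst_closed {γ₀ : ℝ → E3} {ι : Type} (ρ : ι → ScalarField γ₀) (e : ClosedExpr) :
    (e.subst (Empty.elim : Empty → Expr ι)).eval ρ = e.val γ₀ := by
  induction e with
  | var i => exact i.elim
  | _ => simp_all [Expr.subst, Expr.eval, Expr.val]

theorem HasDegree.subst_closed {ι : Type} (d : ι → ℤ) {e : ClosedExpr} {n : ℤ} (h : e.Mem n) :
    (e.subst (Empty.elim : Empty → Expr ι)).HasDegree d n := by
  induction h with
  | var i => exact i.elim
  | kappa => exact .kappa
  | kappaInv => exact .kappaInv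
  | tau => exact .tau
  | arc => exact .arc
  | ell => exact .ell
  | one => exact .one
  | add _ _ ih ih' => exact .add ih ih'
  | smul c _ ih => exact .smul c ih
  | mul _ _ ih ih' => exact .mul ih ih'
  | ds _ ih => exact .ds ih
  | dsInv _ ih => exact .dsInv ih
  | int _ ih => exact .int ih
  | weaken _ ih => exact .weaken ih

/-! ### One-forms given by contraction of `Ω₀` with a vector field -/

/-- The one-form `c Ω₀(Y, ·)`. -/
def contraction (c : ℝ) (Y : VField) : FormExpr 1 :=
  .smul c (.int (pairing (Y.1.subst Empty.elim) (argument 0)))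

theorem contraction_apply (c : ℝ) (Y V : VField) :
    (contraction c Y).apply ![V] = .smul c (.int (pairing Y.1 V.1)) := by
  have h : (Y.1.subst Empty.elim).subst (fun k : Fin 1 × Fin 2 =>
      if k.2 = 0 then ((![V] : Fin 1 → VField) k.1).1.n else (![V] k.1).1.b) = Y.1 := by
    simp only [NormalExpr.subst, subst_subst_closed]
  exact congrArg (fun Z => Expr.smul c (.int (pairing Z V.1))) h

section
variable {γ₀ : ℝ → E3}

theorem contraction_value (c : ℝ) (Y : VField) (U : Fin 1 → NormalField γ₀) :
    (contraction c Y).value U = fun γ _ => c * ∫ t,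
      (Y.1.n.along γ t * U 0 1 γ t - Y.1.b.along γ t * U 0 0 γ t) := by
  funext γ s
  refine congrArg (c * ·) (integral_congr_ae (.of_forall fun t => ?_))
  change (-1 * (Y.1.b.subst Empty.elim).eval (fun k : Fin 1 × Fin 2 => U k.1 k.2) γ t)
    * U 0 0 γ t + (Y.1.n.subst Empty.elim).eval (fun k : Fin 1 × Fin 2 => U k.1 k.2) γ t
    * U 0 1 γ t = _
  rw [eval_subst_closed, eval_subst_closed]
  simp only [Expr.along]
  ring

theorem exists_vField {X : NormalField γ₀} (hX : X ∈ vectorFields γ₀) :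
    ∃ V : VField, V.1.n.val γ₀ = X 0 ∧ V.1.b.val γ₀ = X 1 := by
  obtain ⟨e, he, h⟩ := hX 0
  obtain ⟨f, hf, h'⟩ := hX 1
  exact ⟨⟨⟨e, f⟩, ⟨he, hf⟩⟩, h, h'⟩

theorem integrable_contraction (Y : VField) {X : NormalField γ₀} (hX : X ∈ vectorFields γ₀)
    (γ : BAL γ₀) : Integrable fun t =>
      Y.1.n.along γ t * X 1 γ t - Y.1.b.along γ t * X 0 γ t := by
  obtain ⟨V, h0, h1⟩ := exists_vField hX
  refine (Expr.Mem.integrable γ (pairing_mem Y.2 V.2)).congr (.of_forall fun t => ?_)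
  simp only [along_pairing, ← h0, ← h1]
  rfl

/-- Independence of the parameter lets functionals be pulled out of integrals, which gives
ℱ-linearity. -/
theorem functionals_const {F : ScalarField γ₀} (hF : F ∈ functionals γ₀) (γ : BAL γ₀)
    (s t : ℝ) : F γ s = F γ t := by
  induction hF using Algebra.adjoin_induction with
  | mem x hx =>
    obtain rfl | ⟨f, -, rfl⟩ := hx <;> rfl
  | algebraMap r => rfl
  | add x y _ _ hx hy => simp only [Pi.add_apply, hx, hy]
  | mul x y _ _ hx hy => simp only [Pi.mul_apply, hx, hy]

theorem isForm_contraction (c : ℝ) (Y : VField) : IsForm γ₀ (contraction c Y) where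
  degree := .smul c (.int (.add
    (.mul' (.neg (HasDegree.subst_closed _ Y.2.b_mem)) (.var (0, 0)) (by norm_num))
    (.mul' (HasDegree.subst_closed _ Y.2.n_mem) (.var (0, 1)) (by norm_num))))
  value_mem U hU := by
    obtain ⟨V, h0, h1⟩ := exists_vField (hU 0)
    rw [contraction_value]
    refine (functionals γ₀).smul_mem (x := fun γ _ => ∫ t,
      (Y.1.n.along γ t * U 0 1 γ t - Y.1.b.along γ t * U 0 0 γ t)) ?_ c
    refine Algebra.subset_adjoin (Or.inr ⟨_, ⟨_, pairing_mem Y.2 V.2, rfl⟩, ?_⟩)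
    funext γ _
    refine integral_congr_ae (.of_forall fun t => ?_)
    change _ = (pairing Y.1 V.1).along γ t
    simp only [along_pairing, ← h0, ← h1]
    rfl
  map_add U hU i X hX Z hZ := by
    obtain rfl := Subsingleton.elim 0 i
    simp only [contraction_value, Function.update_self]
    funext γ _
    simp only [Pi.add_apply]
    rw [← mul_add, ← integral_add (integrable_contraction Y hX γ) (integrable_contraction Y hZ γ)]
    congr 2
    funext t
    ring
  map_mul U hU i F hF X hX := by
    obtain rfl := Subsingleton.elim 0 i
    simp only [contraction_value, Function.update_self]
    funext γ s
    simp only [Pi.mul_apply]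
    rw [mul_left_comm, ← integral_const_mul (F γ s)]
    refine congrArg (c * ·) (integral_congr_ae (.of_forall fun t => ?_))
    simp only
    rw [functionals_const hF γ t s]
    ring
  skew U hU i j hij := (hij (Subsingleton.elim i j)).elim

/-- Cartan's formula: as ω is closed, the exterior derivative of ω(Y, ·) is L_Yω. -/
theorem extDeriv_contraction (c : ℝ) (Y : VField) (U : Fin 2 → VField) (γ : BAL γ₀) (s : ℝ) :
    extDeriv γ₀ (contraction c Y) U γ s =
      c * (symplecticVariation γ Y (U 0) (U 1) - symplectic γ (bracket Y (U 0)) (U 1)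
        - symplectic γ (U 0) (bracket Y (U 1))) := by
  have H := isHereditaryPair_symplectic γ
  have e : ∀ X V : VField, (variation X.1 (.smul c (.int (pairing Y.1 V.1)))).val γ₀ γ s =
      c * symplecticVariation γ X Y V := fun X V =>
    congrArg (c * ·) (congrFun (symplecticVariation_eq γ X Y V) s)
  have e' : ∀ V : VField, (Expr.smul c (.int (pairing Y.1 V.1))).val γ₀ γ s =
      c * symplectic γ Y V := fun V =>
    congrArg (c * ·) (congrFun (symplectic_eq γ Y V) s)
  simp only [extDeriv, contraction_apply, Pi.sub_apply, e, e']
  linear_combination c * (H.variation_skew (U 0) Y (U 1) + H.skew (U 0) (bracket Y (U 1))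
    - H.bracket_skew (U 1) Y (U 0) - H.skew Y (bracket (U 0) (U 1)) - H.closed Y (U 0) (U 1))

end

end VortexFilament

end

theorem proposition10 (γ₀ : ℝ → VortexFilament.E3)
    (hγ₀ : VortexFilament.IsReferenceCurve γ₀) :
    (∀ m n : ℕ, 1 ≤ m → ∀ U : Fin 2 → VortexFilament.VField,
      VortexFilament.lieDeriv γ₀ (VortexFilament.symmetry (m - 1)) (VortexFilament.Omega n) U
        = 0) ∧
    (∀ m n : ℕ, 1 ≤ m → ∀ U : Fin 2 → VortexFilament.VField,
      VortexFilament.lieDeriv γ₀ (VortexFilament.masterSymmetry m) (VortexFilament.Omega n) U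
        = (3 - (m : ℝ) - (n : ℝ)) • ((VortexFilament.Omega (m + n)).apply U).val γ₀) ∧
    (∀ n : ℕ, n ≠ 0 → n ≠ 3 → VortexFilament.IsExact γ₀ (VortexFilament.Omega n)) := by
  open VortexFilament in
  refine ⟨fun m n _ U => ?_, fun m n hm U => ?_, fun n h0 h3 => ?_⟩
  · funext γ s
    rw [lieDeriv_Omega, (scales_symmetry γ (m - 1)).lieDeriv_iterate (isHereditaryPair_symplectic γ)]
    simp
  · funext γ s
    rw [lieDeriv_Omega, (scales_masterSymmetry γ hm).lieDeriv_iterate (isHereditaryPair_symplectic γ)]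
    simp only [Pi.smul_apply, smul_eq_mul, Omega_apply_val]
    ring
  -- The primitive is Ω₀(Yₙ, ·) divided by the factor in L_{Yₙ}Ω₀ = (3 − n)Ωₙ, which vanishes
  -- exactly for n = 3.
  · refine ⟨contraction (3 - (n : ℝ))⁻¹ (masterSymmetry n), isForm_contraction _ _, fun U => ?_⟩
    have h : (3 - (n : ℝ)) ≠ 0 := sub_ne_zero.2 (by exact_mod_cast h3.symm)
    funext γ s
    rw [extDeriv_contraction, (scales_masterSymmetry γ (Nat.one_le_iff_ne_zero.2 h0)).form,
      inv_mul_cancel_left₀ h, Omega_apply_val]
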